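/- Let $n\in\mathbb N$, $T>0$, let $\Omega\subset\mathbb R^n$ and $\Lambda\subset\mathbb R$ be open, $f:\Lambda\times\Omega\times[0,T]\to\mathbb R^n$, $g:\Omega\times[0,T]\to\mathbb R^n$, and let $h:(-\infty,T]\to\mathbb R$ be left-continuous, of bounded variation on $[0,T]$, with $h(t)=h(0)$ for $t<0$. Let $\|y\|=\sum_i|y_i|$ on $\mathbb R^n$. Assume: (i) $f(\lambda,\cdot,t)$ is continuous on $\Omega$ for all $\lambda\in\Lambda$, $t\in[0,T]$; $f(\lambda,y,\cdot)$ is Lebesgue measurable on $[0,T]$ for all $(\lambda,y)\in\Lambda\times\Omega$; and there is a Lebesgue integrable $m:[0,T]\to[0,\infty)$ with $\|f(\lambda,y,t)\|\le m(t)$ on $\Lambda\times\Omega\times[0,T]$; (ii) $g(\cdot,t)$ is continuous on $\Omega$ for all $t\in[0,T]$, and there is $m_h:[0,T]\to[0,\infty)$ with $\|g(y,t)\|\le m_h(t)$ on $\Omega\times[0,T]$ for which the Kurzweil–Stieltjes integral $\int_0^T m_h(t)\,d[\mathrm{var}_0^t h]$ exists (and is finite). Integrals with respect to $dh$ and $ds$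 below are Kurzweil–Stieltjes integrals. Let $\mathcal D$ be the space of $C^\infty$ functions $\varphi:\mathbb R\to\mathbb R$ all of whose derivatives, including $\varphi$ itself, vanish outside $(0,T)$, where $\varphi_k\to\varphi$ means uniform convergence of all derivatives. The $n$-vector distributions are the continuous linear functionals on $\mathcal D^n$; a function $u\in L^1[0,T]$ is identified with $\varphi\mapsto\int_0^T u(t)\cdot\varphi(t)\,dt$, and $\langle Du,\varphi\rangle=-\langle u,\varphi'\rangle$. If $\int_0^T v\,dh$ exists, the product $v\,.\,Dh$ is defined as the distributional derivative of $t\mapsto\int_0^t v\,dh$. For $\lambda\in\Lambda$, a function $x:[0,T]\to\mathbb R^n$ *solves the measure differential equation* $Dx=f(\lambda,x,t)+g(x,t)\,.\,Dh$ if $x$ has bounded variation on $[0,T]$, is left-continuous on $(0,T]$, has values in $\Omega$, the product $g(x(\cdot),\cdot)\,.\,Dh$ has a sense, and $\langle Dx,\varphi\rangle=\langle f(\lambda,x(\cdot),\cdot),\varphi\rangle+\langle g(x(\cdot),\cdot)\,.\,Dh,\varphi\rangle$ for all $\varphi\in\mathcal D^n$. It *solves the Stieltjes integral equation* if it has values in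 $\Omega$ and, for all $t\in[0,T]$, the integrals exist and $$x(t)=x(0)+\int_0^t f(\lambda,x(s),s)\,ds+\int_0^t g(x(s),s)\,dh(s).$$ Then for every $\lambda\in\Lambda$ and every regulated $x:[0,T]\to\mathbb R^n$: (a) $x$ solves the Stieltjes integral equation if and only if $x$ solves the measure differential equation and satisfies, at the initial point, $x(0+)-x(0)=g(x(0),0)\,\big(h(0+)-h(0)\big)$; (b) if $x$ solves the measure differential equation (with no condition at $0$), then for all $0<s\le t\le T$ the integrals below exist and $x(t)=x(s)+\int_s^t f(\lambda,x(r),r)\,dr+\int_s^t g(x(r),r)\,dh(r)$. -/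

import Mathlib

open MeasureTheory Set Filter Topology
open scoped ContDiff

/-- `ℝⁿ`. Limits, bounded variation and Kurzweil integrals of `ℝⁿ`-valued functions do not depend
on the choice of the norm; where the norm `∑ i, |x i|` occurs in an estimate, it is `norm1`. -/
abbrev Vec (n : ℕ) : Type := Fin n → ℝ

/-- The norm `∑ i, |x i|` of `ℝⁿ`. -/
def norm1 {n : ℕ} (x : Vec n) : ℝ := ∑ i, |x i|

/-! ### Regulated functions

Functions on `[a, b]` are modelled by functions on `ℝ`, of which only the values on `[a, b]`
matter. -/

/-- `x` is regulated on `[a, b]`: the one-sided limits exist at the points of `(a, b]` and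
`[a, b)`. -/
def IsRegulatedOn {E : Type*} [TopologicalSpace E] (x : ℝ → E) (a b : ℝ) : Prop :=
  (∀ t ∈ Ioc a b, ∃ l, Tendsto x (𝓝[<] t) (𝓝 l)) ∧
    (∀ t ∈ Ico a b, ∃ l, Tendsto x (𝓝[>] t) (𝓝 l))

/-- `x` is left-continuous at every point of `S`. -/
def IsLeftContinuousOn {E : Type*} [TopologicalSpace E] (x : ℝ → E) (S : Set ℝ) : Prop :=
  ∀ t ∈ S, Tendsto x (𝓝[<] t) (𝓝 (x t))

/-- `Δ⁺x(t) = x(t+) - x(t)` exists and equals `d`. -/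
def HasRightJump {E : Type*} [NormedAddCommGroup E] (x : ℝ → E) (t : ℝ) (d : E) : Prop :=
  Tendsto (fun s => x s - x t) (𝓝[>] t) (𝓝 d)

/-! ### The Kurzweil and the Kurzweil–Stieltjes integral -/

/-- Tagged partitions of `[a, b]`: division points `a = t₀ ≤ t₁ ≤ ⋯ ≤ t_ν = b`, where
`t_j = pt j`, and tags `tag j ∈ [pt j, pt (j + 1)]` for `j < ν`. The values of `pt` and `tag` at
larger indices play no role. -/
structure TaggedDivision (a b : ℝ) where
  size : ℕ
  pt : ℕ → ℝ
  tag : ℕ → ℝ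
  pt_zero : pt 0 = a
  pt_size : pt size = b
  tag_mem : ∀ j < size, tag j ∈ Icc (pt j) (pt (j + 1))

/-- `[t_{j-1}, t_j] ⊆ (τ_j - δ(τ_j), τ_j + δ(τ_j))` for all `j`. -/
def TaggedDivision.IsFine {a b : ℝ} (P : TaggedDivision a b) (δ : ℝ → ℝ) : Prop :=
  ∀ j < P.size,
    Icc (P.pt j) (P.pt (j + 1)) ⊆ Ioo (P.tag j - δ (P.tag j)) (P.tag j + δ (P.tag j))

/-- The sum `∑ⱼ [U(τ_j, t_j) - U(τ_j, t_{j-1})]`. -/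
def TaggedDivision.kurzweilSum {a b : ℝ} {E : Type*} [NormedAddCommGroup E]
    (P : TaggedDivision a b) (U : ℝ → ℝ → E) : E :=
  ∑ j ∈ Finset.range P.size, (U (P.tag j) (P.pt (j + 1)) - U (P.tag j) (P.pt j))

/-- `∫_a^b DU(τ, t)` exists and equals `I`, for `a ≤ b` (for `a = b` this means `I = 0`). -/
def HasKurzweilIntegral {E : Type*} [NormedAddCommGroup E] (U : ℝ → ℝ → E) (a b : ℝ) (I : E) :
    Prop :=
  a ≤ b ∧ ∀ ε > 0, ∃ δ : ℝ → ℝ, (∀ τ ∈ Icc a b, 0 < δ τ) ∧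
    ∀ P : TaggedDivision a b, P.IsFine δ → ‖P.kurzweilSum U - I‖ < ε

/-- The Kurzweil–Stieltjes integral `∫_a^b g dh` exists and equals `I`. -/
def HasKSIntegral {E : Type*} [NormedAddCommGroup E] [NormedSpace ℝ E] (g : ℝ → E) (h : ℝ → ℝ)
    (a b : ℝ) (I : E) : Prop :=
  HasKurzweilIntegral (fun τ t => h t • g τ) a b I

/-- The Kurzweil–Stieltjes integral `∫_a^b g dh` exists. -/
def KSIntegrable {E : Type*} [NormedAddCommGroup E] [NormedSpace ℝ E] (g : ℝ → E) (h : ℝ → ℝ)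
    (a b : ℝ) : Prop :=
  ∃ I : E, HasKSIntegral g h a b I

open Classical in
/-- The value of `∫_a^b g dh` (and `0` if the integral does not exist). -/
noncomputable def ksIntegral {E : Type*} [NormedAddCommGroup E] [NormedSpace ℝ E] (g : ℝ → E)
    (h : ℝ → ℝ) (a b : ℝ) : E :=
  if H : KSIntegrable g h a b then H.choose else 0

/-- `var_a^t h`. -/
noncomputable def varFrom (h : ℝ → ℝ) (a t : ℝ) : ℝ := (eVariationOn h (Icc a t)).toReal

/-! ### Test functions and vector distributions on `[0, T]` -/

/-- The space `𝒟` of smooth functions all of whose derivatives vanish outside `(0, T)`. -/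
def testSpace (T : ℝ) : Submodule ℝ (ℝ → ℝ) where
  carrier := {φ | ContDiff ℝ ∞ φ ∧ ∀ (j : ℕ) (t : ℝ), t ∉ Ioo 0 T → iteratedDeriv j φ t = 0}
  zero_mem' := by
    refine ⟨contDiff_const, fun j t _ => ?_⟩
    have h0 : (0 : ℝ → ℝ) = fun _ => 0 := rfl
    rw [h0, iteratedDeriv_const]
    simp
  add_mem' := by
    rintro φ ψ ⟨hφ, hφ'⟩ ⟨hψ, hψ'⟩
    refine ⟨hφ.add hψ, fun j t ht => ?_⟩
    rw [iteratedDeriv_add ((hφ.of_le (by exact_mod_cast le_top)).contDiffAt)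
      ((hψ.of_le (by exact_mod_cast le_top)).contDiffAt), hφ' j t ht, hψ' j t ht, add_zero]
  smul_mem' := by
    rintro c φ ⟨hφ, hφ'⟩
    refine ⟨contDiff_const.smul hφ, fun j t ht => ?_⟩
    rw [iteratedDeriv_const_smul ((hφ.of_le (by exact_mod_cast le_top)).contDiffAt), hφ' j t ht,
      smul_zero]

/-- The Cartesian power `𝒟ⁿ`. -/
abbrev VecTest (n : ℕ) (T : ℝ) : Type := Fin n → testSpace T

/-- `φ_k → φ` in `𝒟ⁿ`: for every order `j`, the `j`-th derivatives of all components converge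
uniformly on `ℝ`. -/
def TestTendsto {n : ℕ} {T : ℝ} (Φ : ℕ → VecTest n T) (φ : VecTest n T) : Prop :=
  ∀ (i : Fin n) (j : ℕ), TendstoUniformly (fun k => iteratedDeriv j (Φ k i : ℝ → ℝ))
    (iteratedDeriv j (φ i : ℝ → ℝ)) atTop

/-- The `n`-vector distributions on `[0, T]`: the linear functionals on `𝒟ⁿ` which are continuous
for the convergence of `𝒟ⁿ`. -/
def vecDistribution (n : ℕ) (T : ℝ) : Submodule ℝ (VecTest n T →ₗ[ℝ] ℝ) where
  carrier := {L | ∀ (Φ : ℕ → VecTest n T) (φ : VecTest n T), TestTendsto Φ φ →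
    Tendsto (fun k => L (Φ k)) atTop (𝓝 (L φ))}
  zero_mem' := fun _ _ _ => tendsto_const_nhds
  add_mem' := fun hK hL Φ φ hΦ => (hK Φ φ hΦ).add (hL Φ φ hΦ)
  smul_mem' := fun c _ hL Φ φ hΦ => (hL Φ φ hΦ).const_mul c

/-- The derivative `φ'` of a test function, as a linear map on `𝒟`. -/
noncomputable def testDeriv (T : ℝ) : testSpace T →ₗ[ℝ] testSpace T where
  toFun φ := ⟨deriv (φ : ℝ → ℝ), by
    refine ⟨(contDiff_infty_iff_deriv.1 φ.2.1).2, fun j t ht => ?_⟩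
    rw [← iteratedDeriv_succ']
    exact φ.2.2 (j + 1) t ht⟩
  map_add' φ ψ := by
    ext t
    exact deriv_add ((contDiff_infty_iff_deriv.1 φ.2.1).1 t) ((contDiff_infty_iff_deriv.1 ψ.2.1).1 t)
  map_smul' c φ := by
    ext t
    exact deriv_const_smul c ((contDiff_infty_iff_deriv.1 φ.2.1).1 t)

/-- The value `⟨d, φ⟩` of a distribution on a test function. -/
def pairing {n : ℕ} {T : ℝ} (d : vecDistribution n T) (φ : VecTest n T) : ℝ := d.1 φ

/-- The componentwise derivative `φ'` of `φ ∈ 𝒟ⁿ`. -/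
noncomputable def vecTestDeriv (n : ℕ) (T : ℝ) : VecTest n T →ₗ[ℝ] VecTest n T :=
  LinearMap.pi fun i => testDeriv T ∘ₗ LinearMap.proj i

/-- The distributional derivative, `⟨Dd, φ⟩ = -⟨d, φ'⟩`. -/
noncomputable def distDeriv {n : ℕ} {T : ℝ} (d : vecDistribution n T) : vecDistribution n T :=
  ⟨-((d : VecTest n T →ₗ[ℝ] ℝ) ∘ₗ vecTestDeriv n T), by
    intro Φ φ hΦ
    refine (d.2 (fun k => vecTestDeriv n T (Φ k)) (vecTestDeriv n T φ) fun i j => ?_).neg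
    have key : ∀ ψ : VecTest n T, iteratedDeriv j (vecTestDeriv n T ψ i : ℝ → ℝ)
        = iteratedDeriv (j + 1) (ψ i : ℝ → ℝ) := fun ψ => by
      rw [iteratedDeriv_succ']; rfl
    simp only [key]
    exact hΦ i (j + 1)⟩

/-- `u ∈ L¹[0, T]`. -/
def IsL1 {n : ℕ} (T : ℝ) (u : ℝ → Vec n) : Prop := IntegrableOn u (Icc 0 T)

lemma integrableOn_coord_mul {n : ℕ} {T : ℝ} {u : ℝ → Vec n} (hu : IsL1 T u)
    (i : Fin n) {ψ : ℝ → ℝ} (hψ : Continuous ψ) :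
    IntegrableOn (fun t => u t i * ψ t) (Icc 0 T) := by
  have h1 : IntegrableOn (fun t => u t i) (Icc 0 T) := Integrable.eval hu i
  exact h1.mul_continuousOn hψ.continuousOn isCompact_Icc

/-- The distribution `⟨u, φ⟩ = ∫_0^T u(t) φ(t) dt` (scalar product of vectors under the integral)
of a function `u` which is Lebesgue integrable on `[0, T]`. -/
noncomputable def distOfFun {n : ℕ} {T : ℝ} (u : ℝ → Vec n) (hu : IsL1 T u) :
    vecDistribution n T :=
  ⟨{  toFun := fun φ => ∫ t in Icc 0 T, ∑ i, u t i * (φ i : ℝ → ℝ) t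
      map_add' := fun φ ψ => by
        rw [← integral_add
          (integrable_finsetSum _ fun i _ => integrableOn_coord_mul hu i (φ i).2.1.continuous)
          (integrable_finsetSum _ fun i _ => integrableOn_coord_mul hu i (ψ i).2.1.continuous)]
        simp [mul_add, Finset.sum_add_distrib]
      map_smul' := fun c φ => by
        simp only [RingHom.id_apply, smul_eq_mul, ← integral_const_mul]
        congr 1
        ext t
        simp only [Pi.smul_apply, SetLike.val_smul, smul_eq_mul, Finset.mul_sum]
        exact Finset.sum_congr rfl fun i _ => by ring }, by
    intro Φ φ hΦ
    have hunif : ∀ i, TendstoUniformly (fun k => (Φ k i : ℝ → ℝ)) (φ i : ℝ → ℝ) atTop := fun i => by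
      simpa using hΦ i 0
    refine tendsto_integral_filter_of_dominated_convergence
      (fun t => ∑ i, ‖u t i * (|(φ i : ℝ → ℝ) t| + 1)‖) (.of_forall fun k => ?_) ?_ ?_ ?_
    · exact (integrable_finsetSum _ fun i _ =>
        integrableOn_coord_mul hu i (Φ k i).2.1.continuous).aestronglyMeasurable
    · have hev : ∀ᶠ k in atTop, ∀ i t, dist ((φ i : ℝ → ℝ) t) ((Φ k i : ℝ → ℝ) t) < 1 :=
        eventually_all.2 fun i => Metric.tendstoUniformly_iff.1 (hunif i) 1 one_pos
      filter_upwards [hev] with k hk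
      refine .of_forall fun t => (norm_sum_le _ _).trans (Finset.sum_le_sum fun i _ => ?_)
      rw [norm_mul, norm_mul]
      refine mul_le_mul_of_nonneg_left ?_ (norm_nonneg _)
      have h1 := hk i t
      rw [Real.dist_eq, abs_sub_comm] at h1
      have h2 := abs_sub_abs_le_abs_sub ((Φ k i : ℝ → ℝ) t) ((φ i : ℝ → ℝ) t)
      rw [Real.norm_eq_abs, Real.norm_eq_abs, abs_of_nonneg (a := |_| + 1) (by positivity)]
      linarith
    · exact integrable_finsetSum _ fun i _ =>
        (integrableOn_coord_mul hu i ((φ i).2.1.continuous.abs.add continuous_const)).norm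
    · refine .of_forall fun t => tendsto_finsetSum _ fun i _ => ?_
      exact ((hunif i).tendsto_at t).const_mul _⟩

/-! ### The measure differential equation and the Stieltjes integral equation -/

/-- The product `g . Dh` has a sense and equals `P`: the integral `∫_0^T g dh` exists, and `P` is
the distributional derivative of the indefinite integral `t ↦ ∫_0^t g dh`. -/
def IsKSProduct {n : ℕ} {T : ℝ} (g : ℝ → Vec n) (h : ℝ → ℝ) (P : vecDistribution n T) : Prop :=
  KSIntegrable g h 0 T ∧
    ∃ hH : IsL1 T (fun t => ksIntegral g h 0 t),
      P = distDeriv (distOfFun (fun t => ksIntegral g h 0 t) hH)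

/-- `(x, lam)` solves `Dx = f(lam, x, t) + g(x, t) . Dh` on `[0, T]`: `x` has bounded variation on
`[0, T]`, is left-continuous on `(0, T]`, has values in `Ω`, the product `g(x(t), t) . Dh` has a
sense and `⟨Dx, φ⟩ = ⟨f(lam, x(·), ·), φ⟩ + ⟨g(x(·), ·) . Dh, φ⟩` for all `φ ∈ 𝒟ⁿ`. -/
def IsMDESolution {n : ℕ} (T : ℝ) (Ω : Set (Vec n)) (f : ℝ → Vec n → ℝ → Vec n)
    (g : Vec n → ℝ → Vec n) (h : ℝ → ℝ) (lam : ℝ) (x : ℝ → Vec n) : Prop :=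
  BoundedVariationOn x (Icc 0 T) ∧ IsLeftContinuousOn x (Ioc 0 T) ∧ (∀ t ∈ Icc 0 T, x t ∈ Ω) ∧
    ∃ (P : vecDistribution n T) (hx : IsL1 T x) (hf : IsL1 T (fun t => f lam (x t) t)),
      IsKSProduct (fun t => g (x t) t) h P ∧
        ∀ φ : VecTest n T, pairing (distDeriv (distOfFun x hx)) φ
          = pairing (distOfFun (fun t => f lam (x t) t) hf) φ + pairing P φ

/-- `x` satisfies
`x(t) = x(s) + ∫_s^t f(lam, x(r), r) dr + ∫_s^t g(x(r), r) dh(r)`,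
both integrals existing as Kurzweil–Stieltjes integrals. -/
def StieltjesEquationAt {n : ℕ} (f : ℝ → Vec n → ℝ → Vec n)
    (g : Vec n → ℝ → Vec n) (h : ℝ → ℝ) (lam : ℝ) (x : ℝ → Vec n) (s t : ℝ) : Prop :=
  KSIntegrable (fun r => f lam (x r) r) (fun r => r) s t ∧
    KSIntegrable (fun r => g (x r) r) h s t ∧
      x t = x s + ksIntegral (fun r => f lam (x r) r) (fun r => r) s t
        + ksIntegral (fun r => g (x r) r) h s t

/-- `x` solves the Stieltjes integral equation
`x(t) = x(0) + ∫_0^t f(lam, x(s), s) ds + ∫_0^t g(x(s), s) dh(s)`, `t ∈ [0, T]`. -/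
def IsSIESolution {n : ℕ} (T : ℝ) (Ω : Set (Vec n)) (f : ℝ → Vec n → ℝ → Vec n)
    (g : Vec n → ℝ → Vec n) (h : ℝ → ℝ) (lam : ℝ) (x : ℝ → Vec n) : Prop :=
  (∀ t ∈ Icc 0 T, x t ∈ Ω) ∧ ∀ t ∈ Icc 0 T, StieltjesEquationAt f g h lam x 0 t

/-!
Let `w(t) = x(t) - ∫_0^t f(lam, x(s), s) ds - ∫_0^t g(x(s), s) dh(s)`. The measure differential
equation says that the distributional derivative of `w` vanishes, i.e. (du Bois-Reymond) that `w` is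
almost everywhere constant. Since `h` and `x` are left-continuous, so is `w`, which is therefore
constant on `(0, T]`; this is (b). At `0` the right jump of `w` is
`x(0+) - x(0) - g(x(0), 0) (h(0+) - h(0))`, so the initial condition says precisely that this
constant is `w(0) = x(0)`, and the integral equation says that `w = x(0)` on all of `[0, T]`.

A solution of the integral equation has the regularity required of a solution of the measure
differential equation because its increments are dominated by those of the monotone function
`∫_0^t m ds + ∫_0^t m_h d(var h)`; its superposition with the Carathéodory function `f` is then
Lebesgue integrable, and the Lebesgue and Kurzweil integrals agree on it.
-/
namespace TaggedDivision

variable {a b c : ℝ} {δ : ℝ → ℝ}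

lemma pt_le_pt_succ (P : TaggedDivision a b) {j : ℕ} (hj : j < P.size) :
    P.pt j ≤ P.pt (j + 1) :=
  (P.tag_mem j hj).1.trans (P.tag_mem j hj).2

lemma left_le_pt (P : TaggedDivision a b) {j : ℕ} (hj : j ≤ P.size) : a ≤ P.pt j := by
  induction j with
  | zero => exact P.pt_zero.ge
  | succ j ih => exact (ih (by omega)).trans (P.pt_le_pt_succ (by omega))

lemma pt_le_right (P : TaggedDivision a b) {j : ℕ} (hj : j ≤ P.size) : P.pt j ≤ b := by
  induction hj using Nat.decreasingInduction with
  | self => exact P.pt_size.le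
  | of_succ k hk ih => exact (P.pt_le_pt_succ hk).trans ih

lemma pt_mem_Icc (P : TaggedDivision a b) {j : ℕ} (hj : j ≤ P.size) : P.pt j ∈ Icc a b :=
  ⟨P.left_le_pt hj, P.pt_le_right hj⟩

lemma Icc_pt_subset (P : TaggedDivision a b) {j : ℕ} (hj : j < P.size) :
    Icc (P.pt j) (P.pt (j + 1)) ⊆ Icc a b :=
  Icc_subset_Icc (P.left_le_pt hj.le) (P.pt_le_right hj)

lemma tag_mem_Icc (P : TaggedDivision a b) {j : ℕ} (hj : j < P.size) : P.tag j ∈ Icc a b :=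
  P.Icc_pt_subset hj (P.tag_mem j hj)

lemma IsFine.mono {P : TaggedDivision a b} {δ' : ℝ → ℝ} (hP : P.IsFine δ)
    (hδ : ∀ t ∈ Icc a b, δ t ≤ δ' t) : P.IsFine δ' := fun j hj => by
  have := hδ _ (P.tag_mem_Icc hj)
  exact (hP j hj).trans (Ioo_subset_Ioo (by linarith) (by linarith))

/-- The tagged division of `[a, b]` into the single interval `[a, b]` with tag `τ`. -/
def single {τ : ℝ} (hτ : τ ∈ Icc a b) : TaggedDivision a b where
  size := 1
  pt j := if j = 0 then a else b
  tag _ := τ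
  pt_zero := rfl
  pt_size := rfl
  tag_mem j hj := by
    obtain rfl : j = 0 := Nat.lt_one_iff.1 hj
    exact hτ

lemma isFine_single {τ : ℝ} (hτ : τ ∈ Icc a b) (ha : τ - δ τ < a) (hb : b < τ + δ τ) :
    (single hτ).IsFine δ := by
  intro j hj
  obtain rfl : j = 0 := Nat.lt_one_iff.1 hj
  exact fun t ht => ⟨ha.trans_le ht.1, ht.2.trans_lt hb⟩

lemma kurzweilSum_single {E : Type*} [NormedAddCommGroup E] {τ : ℝ} (hτ : τ ∈ Icc a b)
    (U : ℝ → ℝ → E) : (single hτ).kurzweilSum U = U τ b - U τ a := by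
  simp [single, kurzweilSum]

/-- The concatenation of tagged divisions of `[a, b]` and `[b, c]`: a tagged division of `[a, c]`
through which the additivity of the Kurzweil integral is proved. -/
def concat (P : TaggedDivision a b) (Q : TaggedDivision b c) : TaggedDivision a c where
  size := P.size + Q.size
  pt j := if j < P.size then P.pt j else Q.pt (j - P.size)
  tag j := if j < P.size then P.tag j else Q.tag (j - P.size)
  pt_zero := by
    split_ifs with h
    · exact P.pt_zero
    · have h0 : P.size = 0 := by omega
      rw [Nat.zero_sub, Q.pt_zero, ← P.pt_size, h0, P.pt_zero]
  pt_size := by simp [Q.pt_size]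
  tag_mem j hj := by
    rcases lt_trichotomy (j + 1) P.size with h | h | h
    · have hj' : j < P.size := by omega
      rw [if_pos hj', if_pos hj', if_pos h]
      exact P.tag_mem j hj'
    · have hj' : j < P.size := by omega
      have hb : P.pt (j + 1) = b := by rw [h, P.pt_size]
      rw [if_pos hj', if_pos hj', if_neg h.ge.not_gt, h, Nat.sub_self, Q.pt_zero]
      simpa only [hb] using P.tag_mem j hj'
    · have hj' : ¬ j < P.size := by omega
      rw [if_neg hj', if_neg hj', if_neg h.not_gt, Nat.sub_add_comm (by omega)]
      exact Q.tag_mem _ (by omega)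

lemma concat_pt_of_le (P : TaggedDivision a b) (Q : TaggedDivision b c) {j : ℕ}
    (hj : j ≤ P.size) : (P.concat Q).pt j = P.pt j := by
  rcases hj.lt_or_eq with h | rfl
  · exact if_pos h
  · simp [concat, P.pt_size, Q.pt_zero]

lemma concat_pt_add (P : TaggedDivision a b) (Q : TaggedDivision b c) (j : ℕ) :
    (P.concat Q).pt (P.size + j) = Q.pt j := by
  simp [concat]

lemma concat_tag_of_lt (P : TaggedDivision a b) (Q : TaggedDivision b c) {j : ℕ}
    (hj : j < P.size) : (P.concat Q).tag j = P.tag j :=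
  if_pos hj

lemma concat_tag_add (P : TaggedDivision a b) (Q : TaggedDivision b c) (j : ℕ) :
    (P.concat Q).tag (P.size + j) = Q.tag j := by
  simp [concat]

lemma IsFine.concat {P : TaggedDivision a b} {Q : TaggedDivision b c} (hP : P.IsFine δ)
    (hQ : Q.IsFine δ) : (P.concat Q).IsFine δ := by
  intro j hj
  rcases lt_or_ge j P.size with h | h
  · rw [concat_pt_of_le _ _ h.le, concat_pt_of_le _ _ h, concat_tag_of_lt _ _ h]
    exact hP j h
  · obtain ⟨k, rfl⟩ := Nat.exists_eq_add_of_le h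
    rw [add_assoc, concat_pt_add, concat_pt_add, concat_tag_add]
    exact hQ k (Nat.add_lt_add_iff_left.1 hj)

lemma kurzweilSum_concat {E : Type*} [NormedAddCommGroup E] (P : TaggedDivision a b)
    (Q : TaggedDivision b c) (U : ℝ → ℝ → E) :
    (P.concat Q).kurzweilSum U = P.kurzweilSum U + Q.kurzweilSum U := by
  have hsize : (P.concat Q).size = P.size + Q.size := rfl
  rw [kurzweilSum, hsize, Finset.sum_range_add]
  congr 1
  · refine Finset.sum_congr rfl fun j hj => ?_
    have hj := Finset.mem_range.1 hj
    rw [concat_pt_of_le _ _ hj.le, concat_pt_of_le _ _ hj, concat_tag_of_lt _ _ hj]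
  · refine Finset.sum_congr rfl fun j _ => ?_
    rw [add_assoc, concat_pt_add, concat_pt_add, concat_tag_add]

theorem exists_isFine (hab : a ≤ b) (hδ : ∀ t ∈ Icc a b, 0 < δ t) :
    ∃ P : TaggedDivision a b, P.IsFine δ := by
  let S : Set ℝ := {t | t ∈ Icc a b ∧ ∃ P : TaggedDivision a t, P.IsFine δ}
  let c := sSup S
  have haS : a ∈ S := by
    have ha := left_mem_Icc.2 hab
    have := hδ a ha
    exact ⟨ha, single (left_mem_Icc.2 le_rfl), isFine_single _ (by linarith) (by linarith)⟩
  have hbdd : BddAbove S := ⟨b, fun t ht => ht.1.2⟩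
  have hac : a ≤ c := le_csSup hbdd haS
  have hcb : c ≤ b := csSup_le ⟨a, haS⟩ fun t ht => ht.1.2
  have hδc : 0 < δ c := hδ c ⟨hac, hcb⟩
  obtain ⟨s, hsS, hs⟩ := exists_lt_of_lt_csSup ⟨a, haS⟩ (show c - δ c < sSup S by linarith)
  have hsc : s ≤ c := le_csSup hbdd hsS
  have mem_of_lt : ∀ u ∈ Icc c b, u < c + δ c → u ∈ S := fun u hu hu' => by
    obtain ⟨P, hP⟩ := hsS.2
    exact ⟨⟨hac.trans hu.1, hu.2⟩, P.concat (single ⟨hsc, hu.1⟩),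
      hP.concat (isFine_single _ hs hu')⟩
  rcases hcb.lt_or_eq with hlt | heq
  · have hcu : c < min b (c + δ c / 2) := lt_min hlt (by linarith)
    have huS := mem_of_lt _ ⟨hcu.le, min_le_left _ _⟩ ((min_le_right _ _).trans_lt (by linarith))
    exact absurd (le_csSup hbdd huS) hcu.not_ge
  · exact (mem_of_lt b ⟨hcb, le_rfl⟩ (by linarith)).2

/-- The filter of tagged divisions of `[a, b]` generated by the sets of `δ`-fine ones, where `δ` is
positive on `[a, b]`: the Kurzweil integral is the limit of the Kurzweil sums along it. -/
def fineFilter (a b : ℝ) : Filter (TaggedDivision a b) :=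
  ⨅ (δ : ℝ → ℝ) (_ : ∀ t ∈ Icc a b, 0 < δ t), 𝓟 {P | P.IsFine δ}

lemma hasBasis_fineFilter (a b : ℝ) : (fineFilter a b).HasBasis
    (fun δ : ℝ → ℝ => ∀ t ∈ Icc a b, 0 < δ t) fun δ => {P | P.IsFine δ} :=
  hasBasis_biInf_principal' (fun δ hδ δ' hδ' =>
    ⟨fun t => min (δ t) (δ' t), fun t ht => lt_min (hδ t ht) (hδ' t ht),
      fun _ hP => IsFine.mono (mem_ofPred_eq ▸ hP) fun _ _ => min_le_left _ _,
      fun _ hP => IsFine.mono (mem_ofPred_eq ▸ hP) fun _ _ => min_le_right _ _⟩)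
    ⟨fun _ => 1, fun _ _ => one_pos⟩

lemma eventually_isFine (hδ : ∀ t ∈ Icc a b, 0 < δ t) : ∀ᶠ P in fineFilter a b, P.IsFine δ :=
  (hasBasis_fineFilter a b).mem_of_mem hδ

lemma neBot_fineFilter (hab : a ≤ b) : (fineFilter a b).NeBot :=
  (hasBasis_fineFilter a b).neBot_iff.2 fun hδ => exists_isFine hab hδ

lemma tendsto_concat (hab : a ≤ b) (hbc : b ≤ c) :
    Tendsto (fun p : TaggedDivision a b × TaggedDivision b c => p.1.concat p.2)
      (fineFilter a b ×ˢ fineFilter b c) (fineFilter a c) := by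
  refine (hasBasis_fineFilter a c).tendsto_right_iff.2 fun δ hδ => ?_
  have hleft : ∀ᶠ P in fineFilter a b, P.IsFine δ :=
    eventually_isFine fun t ht => hδ t ⟨ht.1, ht.2.trans hbc⟩
  have hright : ∀ᶠ Q in fineFilter b c, Q.IsFine δ :=
    eventually_isFine fun t ht => hδ t ⟨hab.trans ht.1, ht.2⟩
  exact (hleft.prod_mk hright).mono fun p hp => hp.1.concat hp.2

end TaggedDivision

open TaggedDivision

namespace HasKurzweilIntegral

variable {E : Type*} [NormedAddCommGroup E] {U : ℝ → ℝ → E} {a b c : ℝ} {I J K : E}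

lemma iff_tendsto : HasKurzweilIntegral U a b I ↔
    a ≤ b ∧ Tendsto (fun P => kurzweilSum P U) (fineFilter a b) (𝓝 I) := by
  refine and_congr_right fun _ => ?_
  rw [(hasBasis_fineFilter a b).tendsto_iff Metric.nhds_basis_ball]
  simp [dist_eq_norm]

lemma tendsto (hI : HasKurzweilIntegral U a b I) :
    Tendsto (fun P => kurzweilSum P U) (fineFilter a b) (𝓝 I) :=
  (iff_tendsto.1 hI).2

lemma unique (hI : HasKurzweilIntegral U a b I) (hJ : HasKurzweilIntegral U a b J) : I = J :=
  have := neBot_fineFilter hI.1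
  tendsto_nhds_unique hI.tendsto hJ.tendsto

lemma eq_add (hI : HasKurzweilIntegral U a c I) (hJ : HasKurzweilIntegral U a b J)
    (hK : HasKurzweilIntegral U b c K) : I = J + K := by
  have := neBot_fineFilter hJ.1
  have := neBot_fineFilter hK.1
  refine tendsto_nhds_unique (hI.tendsto.comp (tendsto_concat hJ.1 hK.1)) ?_
  simpa only [Function.comp_def, kurzweilSum_concat] using
    (hJ.tendsto.comp tendsto_fst).add (hK.tendsto.comp tendsto_snd)

lemma exists_iff_cauchy [CompleteSpace E] (hab : a ≤ b) :
    (∃ I, HasKurzweilIntegral U a b I) ↔ ∀ ε > 0, ∃ δ : ℝ → ℝ, (∀ t ∈ Icc a b, 0 < δ t) ∧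
      ∀ P Q : TaggedDivision a b, P.IsFine δ → Q.IsFine δ →
        dist (P.kurzweilSum U) (Q.kurzweilSum U) < ε := by
  have := neBot_fineFilter hab
  simp only [iff_tendsto, hab, true_and]
  rw [← cauchy_map_iff_exists_tendsto, cauchy_map_iff',
    ((hasBasis_fineFilter a b).prod_self).tendsto_iff Metric.uniformity_basis_dist]
  simp only [mem_prod, mem_ofPred_eq, Prod.forall, and_imp]

lemma exists_initial [CompleteSpace E] (hI : HasKurzweilIntegral U a c I) (hab : a ≤ b)
    (hbc : b ≤ c) : ∃ J, HasKurzweilIntegral U a b J := by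
  rw [exists_iff_cauchy hab]
  intro ε hε
  obtain ⟨δ, hδ, hdist⟩ := (exists_iff_cauchy hI.1).1 ⟨I, hI⟩ ε hε
  obtain ⟨R, hR⟩ := exists_isFine hbc fun t ht => hδ t ⟨hab.trans ht.1, ht.2⟩
  refine ⟨δ, fun t ht => hδ t ⟨ht.1, ht.2.trans hbc⟩, fun P Q hP hQ => ?_⟩
  simpa only [kurzweilSum_concat, dist_add_right] using hdist _ _ (hP.concat hR) (hQ.concat hR)

lemma exists_final [CompleteSpace E] (hI : HasKurzweilIntegral U a c I) (hab : a ≤ b)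
    (hbc : b ≤ c) : ∃ J, HasKurzweilIntegral U b c J := by
  rw [exists_iff_cauchy hbc]
  intro ε hε
  obtain ⟨δ, hδ, hdist⟩ := (exists_iff_cauchy hI.1).1 ⟨I, hI⟩ ε hε
  obtain ⟨R, hR⟩ := exists_isFine hab fun t ht => hδ t ⟨ht.1, ht.2.trans hbc⟩
  refine ⟨δ, fun t ht => hδ t ⟨hab.trans ht.1, ht.2⟩, fun P Q hP hQ => ?_⟩
  simpa only [kurzweilSum_concat, dist_add_left] using hdist _ _ (hR.concat hP) (hR.concat hQ)

lemma norm_sub_le_of_forall_isFine {δ : ℝ → ℝ} {ε : ℝ} (hI : HasKurzweilIntegral U a b I)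
    (hδ : ∀ t ∈ Icc a b, 0 < δ t)
    (hJ : ∀ P : TaggedDivision a b, P.IsFine δ → ‖P.kurzweilSum U - J‖ ≤ ε) : ‖I - J‖ ≤ ε :=
  have := neBot_fineFilter hI.1
  le_of_tendsto (hI.tendsto.sub_const J).norm ((eventually_isFine hδ).mono hJ)

/-- The intervals `[s, b]` with tag `b` extend fine divisions of `[a, s]` to fine divisions of
`[a, b]`. -/
lemma tendsto_nhdsLT {G : ℝ → E} (hab : a < b)
    (hG : ∀ t ∈ Icc a b, HasKurzweilIntegral U a t (G t)) :
    Tendsto (fun s => G s + (U b b - U b s)) (𝓝[<] b) (𝓝 (G b)) := by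
  refine Metric.tendsto_nhds.2 fun ε hε => ?_
  obtain ⟨δ, hδ, hGb⟩ := (hG b (right_mem_Icc.2 hab.le)).2 (ε / 2) (half_pos hε)
  have hδb := hδ b (right_mem_Icc.2 hab.le)
  filter_upwards [Ioo_mem_nhdsLT (max_lt hab (sub_lt_self b hδb))] with s ⟨hs, hsb⟩
  obtain ⟨has, hs⟩ := max_lt_iff.1 hs
  have hle : ‖G s - (G b - (U b b - U b s))‖ ≤ ε / 2 := by
    refine (hG s ⟨has.le, hsb.le⟩).norm_sub_le_of_forall_isFine
      (fun t ht => hδ t ⟨ht.1, ht.2.trans hsb.le⟩) fun P hP => ?_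
    have hfine := isFine_single (δ := δ) (right_mem_Icc.2 hsb.le) hs (by linarith)
    have := hGb _ (hP.concat hfine)
    rw [kurzweilSum_concat, kurzweilSum_single] at this
    rw [sub_sub_eq_add_sub]
    exact this.le
  rw [dist_eq_norm, ← sub_sub_eq_add_sub]
  exact hle.trans_lt (half_lt_self hε)

lemma tendsto_nhdsGT [CompleteSpace E] {G : ℝ → E} (hab : a < b)
    (hG : ∀ t ∈ Icc a b, HasKurzweilIntegral U a t (G t)) :
    Tendsto (fun s => G s - (U a s - U a a)) (𝓝[>] a) (𝓝 0) := by
  refine Metric.tendsto_nhds.2 fun ε hε => ?_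
  have hGb := hG b (right_mem_Icc.2 hab.le)
  obtain ⟨δ, hδ, hlt⟩ := hGb.2 (ε / 2) (half_pos hε)
  have hδa := hδ a (left_mem_Icc.2 hab.le)
  filter_upwards [Ioo_mem_nhdsGT (lt_min hab (lt_add_of_pos_right a hδa))] with s ⟨has, hs⟩
  obtain ⟨hsb, hs⟩ := lt_min_iff.1 hs
  obtain ⟨J, hJ⟩ := hGb.exists_final has.le hsb.le
  have hle : ‖J - (G b - (U a s - U a a))‖ ≤ ε / 2 := by
    refine hJ.norm_sub_le_of_forall_isFine
      (fun t ht => hδ t ⟨has.le.trans ht.1, ht.2⟩) fun P hP => ?_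
    have hfine := isFine_single (δ := δ) (left_mem_Icc.2 has.le) (by linarith) hs
    have := hlt _ (hfine.concat hP)
    rw [kurzweilSum_concat, kurzweilSum_single, add_comm] at this
    rw [sub_sub_eq_add_sub]
    exact this.le
  rw [hGb.eq_add (hG s ⟨has.le, hsb.le⟩) hJ, add_sub_right_comm, sub_add_cancel_right,
    norm_neg] at hle
  rw [dist_zero_right]
  exact hle.trans_lt (half_lt_self hε)

end HasKurzweilIntegral

section KurzweilStieltjes

variable {E : Type*} [NormedAddCommGroup E] [NormedSpace ℝ E] {g : ℝ → E} {h : ℝ → ℝ}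
  {a b c d : ℝ} {I : E}

lemma KSIntegrable.hasKSIntegral (hg : KSIntegrable g h a b) :
    HasKSIntegral g h a b (ksIntegral g h a b) := by
  rw [ksIntegral, dif_pos hg]
  exact hg.choose_spec

lemma HasKSIntegral.ksIntegral_eq (hI : HasKSIntegral g h a b I) : ksIntegral g h a b = I :=
  (KSIntegrable.hasKSIntegral ⟨I, hI⟩).unique hI

lemma hasKSIntegral_self (g : ℝ → E) (h : ℝ → ℝ) (a : ℝ) : HasKSIntegral g h a a 0 := by
  refine HasKurzweilIntegral.iff_tendsto.2 ⟨le_rfl, tendsto_const_nhds.congr fun P => Eq.symm ?_⟩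
  have hpt : ∀ j ≤ P.size, P.pt j = a := fun j hj => by simpa using P.pt_mem_Icc hj
  refine Finset.sum_eq_zero fun j hj => ?_
  have hj := Finset.mem_range.1 hj
  rw [hpt _ hj.le, hpt _ hj, sub_self]

lemma ksIntegral_self (g : ℝ → E) (h : ℝ → ℝ) (a : ℝ) : ksIntegral g h a a = 0 :=
  (hasKSIntegral_self g h a).ksIntegral_eq

lemma HasKSIntegral.norm_le {m V : ℝ → ℝ} {M : ℝ} (hI : HasKSIntegral g h a b I)
    (hM : HasKSIntegral m V a b M) (hg : ∀ t ∈ Icc a b, ‖g t‖ ≤ m t)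
    (hV : ∀ s ∈ Icc a b, ∀ t ∈ Icc a b, s ≤ t → |h t - h s| ≤ V t - V s) : ‖I‖ ≤ M := by
  have := neBot_fineFilter hI.1
  refine le_of_tendsto_of_tendsto' (HasKurzweilIntegral.tendsto hI).norm
    (HasKurzweilIntegral.tendsto hM) fun P => ?_
  refine (norm_sum_le _ _).trans (Finset.sum_le_sum fun j hj => ?_)
  have hj := Finset.mem_range.1 hj
  have hVj := hV _ (P.pt_mem_Icc hj.le) _ (P.pt_mem_Icc hj) (P.pt_le_pt_succ hj)
  rw [← sub_smul, ← sub_smul, norm_smul, smul_eq_mul, Real.norm_eq_abs]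
  exact mul_le_mul hVj (hg _ (P.tag_mem_Icc hj)) (norm_nonneg _) ((abs_nonneg _).trans hVj)

namespace KSIntegrable

variable [CompleteSpace E]

lemma mono (hg : KSIntegrable g h a d) (hab : a ≤ b) (hbc : b ≤ c) (hcd : c ≤ d) :
    KSIntegrable g h b c := by
  obtain ⟨I, hI⟩ := hg
  obtain ⟨J, hJ⟩ := HasKurzweilIntegral.exists_initial hI (hab.trans hbc) hcd
  exact hJ.exists_final hab hbc

lemma ksIntegral_sub_ksIntegral (hg : KSIntegrable g h a d) (hab : a ≤ b) (hbc : b ≤ c)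
    (hcd : c ≤ d) : ksIntegral g h a c - ksIntegral g h a b = ksIntegral g h b c := by
  refine sub_eq_of_eq_add' (HasKurzweilIntegral.eq_add (hg.mono le_rfl (hab.trans hbc)
    hcd).hasKSIntegral (hg.mono le_rfl hab (hbc.trans hcd)).hasKSIntegral
    (hg.mono hab hbc hcd).hasKSIntegral)

lemma norm_ksIntegral_sub_le {m V : ℝ → ℝ} (hg : KSIntegrable g h a b) (hm : KSIntegrable m V a b)
    (hgm : ∀ t ∈ Icc a b, ‖g t‖ ≤ m t)
    (hV : ∀ s ∈ Icc a b, ∀ t ∈ Icc a b, s ≤ t → |h t - h s| ≤ V t - V s) {s t : ℝ} (has : a ≤ s)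
    (hst : s ≤ t) (htb : t ≤ b) :
    ‖ksIntegral g h a t - ksIntegral g h a s‖ ≤ ksIntegral m V a t - ksIntegral m V a s := by
  have hsub : Icc s t ⊆ Icc a b := Icc_subset_Icc has htb
  rw [hg.ksIntegral_sub_ksIntegral has hst htb, hm.ksIntegral_sub_ksIntegral has hst htb]
  exact (hg.mono has hst htb).hasKSIntegral.norm_le (hm.mono has hst htb).hasKSIntegral
    (fun r hr => hgm r (hsub hr)) fun r hr r' hr' => hV r (hsub hr) r' (hsub hr')

lemma isLeftContinuousOn_ksIntegral (hg : KSIntegrable g h a b)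
    (hh : IsLeftContinuousOn h (Ioc a b)) : IsLeftContinuousOn (ksIntegral g h a) (Ioc a b) := by
  intro t ht
  have hlim := HasKurzweilIntegral.tendsto_nhdsLT (U := fun τ t => h t • g τ)
    (G := ksIntegral g h a) ht.1 fun s hs => (hg.mono le_rfl hs.1 (hs.2.trans ht.2)).hasKSIntegral
  have hjump : Tendsto (fun s => h t • g t - h s • g t) (𝓝[<] t) (𝓝 0) := by
    simpa using ((hh t ht).smul_const (g t)).const_sub (h t • g t)
  simpa using hlim.sub hjump

lemma hasRightJump_ksIntegral (hg : KSIntegrable g h a b) (hab : a < b) {e : ℝ}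
    (hh : HasRightJump h a e) : HasRightJump (ksIntegral g h a) a (e • g a) := by
  have hlim := HasKurzweilIntegral.tendsto_nhdsGT (U := fun τ t => h t • g τ)
    (G := ksIntegral g h a) hab fun s hs => (hg.mono le_rfl hs.1 hs.2).hasKSIntegral
  simpa [HasRightJump, ksIntegral_self, sub_smul] using hlim.add (Tendsto.smul_const hh (g a))

end KSIntegrable

end KurzweilStieltjes

section LebesgueIntegral

variable {E : Type*} [NormedAddCommGroup E] {a b : ℝ}

lemma TaggedDivision.intervalIntegrable_pt_succ (P : TaggedDivision a b) {u : ℝ → E}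
    (hu : IntervalIntegrable u volume a b) {j : ℕ} (hj : j < P.size) :
    IntervalIntegrable u volume (P.pt j) (P.pt (j + 1)) :=
  hu.mono_set (by
    rw [uIcc_of_le (P.pt_le_pt_succ hj)]
    exact (P.Icc_pt_subset hj).trans Icc_subset_uIcc)

variable [NormedSpace ℝ E]

namespace TaggedDivision

lemma sum_intervalIntegral (P : TaggedDivision a b) {u : ℝ → E}
    (hu : ∀ j < P.size, IntervalIntegrable u volume (P.pt j) (P.pt (j + 1))) :
    ∑ j ∈ Finset.range P.size, ∫ t in P.pt j..P.pt (j + 1), u t = ∫ t in a..b, u t := by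
  rw [intervalIntegral.sum_integral_adjacent_intervals hu, P.pt_zero, P.pt_size]

lemma kurzweilSum_smul [CompleteSpace E] (P : TaggedDivision a b) (f : ℝ → E) :
    P.kurzweilSum (fun τ t => t • f τ)
      = ∑ j ∈ Finset.range P.size, ∫ _ in P.pt j..P.pt (j + 1), f (P.tag j) := by
  simp only [kurzweilSum, intervalIntegral.integral_const, sub_smul]

lemma norm_kurzweilSum_sub_le (P : TaggedDivision a b) (f g : ℝ → E) :
    ‖P.kurzweilSum (fun τ t => t • f τ) - P.kurzweilSum (fun τ t => t • g τ)‖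
      ≤ P.kurzweilSum (fun τ t => t • ‖f τ - g τ‖) := by
  simp only [kurzweilSum, ← Finset.sum_sub_distrib, ← sub_smul, ← smul_sub]
  refine (norm_sum_le _ _).trans_eq (Finset.sum_congr rfl fun j hj => ?_)
  rw [norm_smul, smul_eq_mul, Real.norm_of_nonneg (sub_nonneg.2
    (P.pt_le_pt_succ (Finset.mem_range.1 hj)))]

/-- By lower semicontinuity of `g`, the gauge can be chosen so that `f τ - η < g` on the interval
with tag `τ`. -/
lemma eventually_kurzweilSum_le_of_lowerSemicontinuous {f : ℝ → ℝ} {g : ℝ → EReal} {η : ℝ}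
    (hab : a ≤ b) (hη : 0 < η) (hfg : ∀ t, (f t : EReal) < g t) (hg : LowerSemicontinuous g)
    (hg_int : IntegrableOn (fun t => (g t).toReal) (Icc a b))
    (hg_top : ∀ᵐ t ∂volume.restrict (Icc a b), g t < ⊤) :
    ∀ᶠ P in fineFilter a b,
      P.kurzweilSum (fun τ t => t • f τ) ≤ ∫ t in a..b, ((g t).toReal + η) := by
  have hnhds : ∀ τ, ∃ d > 0, ∀ t ∈ Ioo (τ - d) (τ + d), ((f τ - η : ℝ) : EReal) < g t := fun τ => by
    have hlt : ((f τ - η : ℝ) : EReal) < g τ :=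
      (EReal.coe_le_coe_iff.2 (sub_le_self _ hη.le)).trans_lt (hfg τ)
    obtain ⟨d, hd, hball⟩ := Metric.eventually_nhds_iff_ball.1 (hg τ _ hlt)
    exact ⟨d, hd, fun t ht => hball t (by rwa [Real.ball_eq_Ioo])⟩
  choose δ hδ hδg using hnhds
  filter_upwards [eventually_isFine fun t _ => hδ t] with P hP
  have hint : IntervalIntegrable (fun t => (g t).toReal + η) volume a b :=
    ((intervalIntegrable_iff_integrableOn_Icc_of_le hab).2 hg_int).add intervalIntegrable_const
  rw [kurzweilSum_smul, ← P.sum_intervalIntegral fun _ => P.intervalIntegrable_pt_succ hint]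
  refine Finset.sum_le_sum fun j hj => ?_
  have hj := Finset.mem_range.1 hj
  refine intervalIntegral.integral_mono_ae_restrict (P.pt_le_pt_succ hj) intervalIntegrable_const
    (P.intervalIntegrable_pt_succ hint hj) ?_
  filter_upwards [ae_restrict_of_ae_restrict_of_subset (P.Icc_pt_subset hj) hg_top,
    ae_restrict_mem measurableSet_Icc] with t ht_top ht
  have hle := EReal.toReal_le_toReal (hδg _ t (hP j hj ht)).le (EReal.coe_ne_bot _) ht_top.ne
  rw [EReal.toReal_coe] at hle
  linarith

lemma eventually_kurzweilSum_lt {f : ℝ → ℝ} (hab : a ≤ b) (hf : IntegrableOn f (Icc a b)) {ε : ℝ}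
    (hε : 0 < ε) :
    ∀ᶠ P in fineFilter a b, P.kurzweilSum (fun τ t => t • f τ) < (∫ t in a..b, f t) + ε := by
  let η := ε / (b - a + 1)
  have hη : 0 < η := div_pos hε (by linarith)
  have hηε : (b - a + 1) * η = ε := mul_div_cancel₀ _ (by linarith)
  obtain ⟨g, hfg, hg, hg_int, hg_top, hlt⟩ := exists_lt_lowerSemicontinuous_integral_lt f hf hη
  filter_upwards [eventually_kurzweilSum_le_of_lowerSemicontinuous hab hη hfg hg hg_int hg_top]
    with P hP
  rw [intervalIntegral.integral_add ((intervalIntegrable_iff_integrableOn_Icc_of_le hab).2 hg_int)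
    intervalIntegrable_const, intervalIntegral.integral_const, smul_eq_mul] at hP
  simp only [integral_Icc_eq_integral_Ioc, ← intervalIntegral.integral_of_le hab] at hlt
  linarith

end TaggedDivision

lemma hasKSIntegral_id_of_continuous [CompleteSpace E] {f : ℝ → E} (hab : a ≤ b)
    (hf : Continuous f) : HasKSIntegral f (fun t => t) a b (∫ t in a..b, f t) := by
  refine HasKurzweilIntegral.iff_tendsto.2 ⟨hab, Metric.tendsto_nhds.2 fun ε hε => ?_⟩
  let η := ε / (b - a + 1)
  have hη : 0 < η := div_pos hε (by linarith)
  have hηε : (b - a + 1) * η = ε := mul_div_cancel₀ _ (by linarith)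
  choose δ hδ hfδ using fun τ => Metric.continuousAt_iff.1 (hf.continuousAt (x := τ)) η hη
  filter_upwards [eventually_isFine fun t _ => hδ t] with P hP
  have hint : ∀ {r s : ℝ}, IntervalIntegrable f volume r s := hf.intervalIntegrable _ _
  have hj_le : ∀ j ∈ Finset.range P.size,
      ‖∫ t in P.pt j..P.pt (j + 1), (f (P.tag j) - f t)‖ ≤ P.pt (j + 1) * η - P.pt j * η := by
    intro j hj
    have hj := Finset.mem_range.1 hj
    have hle := P.pt_le_pt_succ hj
    rw [← sub_mul, mul_comm, ← abs_of_nonneg (sub_nonneg.2 hle)]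
    refine intervalIntegral.norm_integral_le_of_norm_le_const fun t ht => ?_
    rw [uIoc_of_le hle] at ht
    rw [← dist_eq_norm, dist_comm]
    refine (hfδ _ ?_).le
    rw [← Metric.mem_ball, Real.ball_eq_Ioo]
    exact hP j hj (Ioc_subset_Icc_self ht)
  rw [dist_eq_norm, kurzweilSum_smul, ← P.sum_intervalIntegral fun _ _ => hint,
    ← Finset.sum_sub_distrib]
  simp only [← intervalIntegral.integral_sub intervalIntegrable_const hint]
  refine ((norm_sum_le _ _).trans (Finset.sum_le_sum hj_le)).trans_lt ?_
  rw [Finset.sum_range_sub fun j => P.pt j * η, P.pt_zero, P.pt_size]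
  linarith

/-- Kurzweil sums of `f` are compared with those of a continuous `g` which is close to `f` in `L¹`:
they differ by at most a Kurzweil sum of `‖f - g‖`. -/
theorem hasKSIntegral_id_of_integrableOn [CompleteSpace E] {f : ℝ → E} (hab : a ≤ b)
    (hf : IntegrableOn f (Icc a b)) : HasKSIntegral f (fun t => t) a b (∫ t in a..b, f t) := by
  refine HasKurzweilIntegral.iff_tendsto.2 ⟨hab, Metric.tendsto_nhds.2 fun ε hε => ?_⟩
  obtain ⟨g, -, hfg, hg, hg_int⟩ :=
    Integrable.exists_hasCompactSupport_integral_sub_le hf (show 0 < ε / 4 by linarith)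
  rw [integral_Icc_eq_integral_Ioc, ← intervalIntegral.integral_of_le hab] at hfg
  have hint : ‖(∫ t in a..b, g t) - ∫ t in a..b, f t‖ ≤ ε / 4 := by
    rw [← intervalIntegral.integral_sub (hg.intervalIntegrable _ _)
      ((intervalIntegrable_iff_integrableOn_Icc_of_le hab).2 hf)]
    refine (intervalIntegral.norm_integral_le_integral_norm hab).trans ?_
    simpa only [norm_sub_rev] using hfg
  filter_upwards [eventually_kurzweilSum_lt hab (hf.sub hg_int).norm (show 0 < ε / 4 by linarith),
    Metric.tendsto_nhds.1 (HasKurzweilIntegral.tendsto (hasKSIntegral_id_of_continuous hab hg))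
      (ε / 4) (by linarith)] with P hPfg hPg
  simp only [Pi.sub_apply] at hPfg
  rw [← dist_eq_norm] at hint
  have hP := P.norm_kurzweilSum_sub_le f g
  rw [← dist_eq_norm] at hP
  calc dist (P.kurzweilSum fun τ t => t • f τ) (∫ t in a..b, f t)
    _ ≤ dist (P.kurzweilSum fun τ t => t • f τ) (P.kurzweilSum fun τ t => t • g τ)
        + dist (P.kurzweilSum fun τ t => t • g τ) (∫ t in a..b, g t)
        + dist (∫ t in a..b, g t) (∫ t in a..b, f t) := dist_triangle4 _ _ _ _
    _ < ε := by linarith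

lemma ksIntegral_id_eq_intervalIntegral [CompleteSpace E] {f : ℝ → E}
    (hf : IntegrableOn f (Icc a b)) {t : ℝ} (ht : t ∈ Icc a b) :
    ksIntegral f (fun r => r) a t = ∫ r in a..t, f r :=
  (hasKSIntegral_id_of_integrableOn ht.1
    (hf.mono_set (Icc_subset_Icc_right ht.2))).ksIntegral_eq

end LebesgueIntegral

section DominatedIncrements

variable {E : Type*} {M : ℝ → ℝ} {a b : ℝ}

lemma monotoneOn_of_dist_le_sub [PseudoMetricSpace E] {f : ℝ → E}
    (hM : ∀ s ∈ Icc a b, ∀ t ∈ Icc a b, s ≤ t → dist (f t) (f s) ≤ M t - M s) :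
    MonotoneOn M (Icc a b) := fun s hs t ht hst =>
  sub_nonneg.1 (dist_nonneg.trans (hM s hs t ht hst))

lemma boundedVariationOn_of_dist_le_sub [PseudoMetricSpace E] {f : ℝ → E}
    (hM : ∀ s ∈ Icc a b, ∀ t ∈ Icc a b, s ≤ t → dist (f t) (f s) ≤ M t - M s) :
    BoundedVariationOn f (Icc a b) := by
  have hmono := monotoneOn_of_dist_le_sub hM
  have hle : eVariationOn f (Icc a b) ≤ eVariationOn M (Icc a b) := by
    refine iSup_mono fun p => Finset.sum_le_sum fun i _ => ?_
    rw [edist_dist, edist_dist, Real.dist_eq]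
    exact ENNReal.ofReal_le_ofReal ((hM _ (p.2.2.2 i) _ (p.2.2.2 (i + 1))
      (p.2.2.1 i.le_succ)).trans (le_abs_self _))
  refine ne_top_of_le_ne_top
    (hmono.boundedVariationOn (C := max |M a| |M b|) fun t ht => ?_) hle
  have hab := ht.1.trans ht.2
  exact abs_le_max_abs_abs (hmono (left_mem_Icc.2 hab) ht ht.1)
    (hmono ht (right_mem_Icc.2 hab) ht.2)

lemma continuousWithinAt_of_dist_le_sub [PseudoMetricSpace E] {f : ℝ → E}
    (hM : ∀ s ∈ Icc a b, ∀ t ∈ Icc a b, s ≤ t → dist (f t) (f s) ≤ M t - M s) {t : ℝ}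
    (ht : t ∈ Icc a b) (hMt : ContinuousWithinAt M (Icc a b) t) :
    ContinuousWithinAt f (Icc a b) t := by
  refine tendsto_iff_dist_tendsto_zero.2 (squeeze_zero' (.of_forall fun _ => dist_nonneg) ?_
    (tendsto_iff_dist_tendsto_zero.1 hMt))
  filter_upwards [self_mem_nhdsWithin] with s hs
  rcases le_total s t with hst | hts
  · rw [dist_comm, dist_comm (M s)]
    exact (hM s hs t ht hst).trans (le_abs_self _)
  · exact (hM t ht s hs hts).trans (le_abs_self _)

/-- `f` is continuous wherever the monotone function `M` is, hence off a countable set. -/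
lemma integrableOn_of_dist_le_sub [NormedAddCommGroup E] {f : ℝ → E}
    (hM : ∀ s ∈ Icc a b, ∀ t ∈ Icc a b, s ≤ t → dist (f t) (f s) ≤ M t - M s) :
    IntegrableOn f (Icc a b) := by
  let C : Set ℝ := {t | t ∈ Icc a b ∧ ¬ContinuousWithinAt M (Icc a b) t}
  have hC : C.Countable := (monotoneOn_of_dist_le_sub hM).countable_not_continuousWithinAt
  have hcont : ContinuousOn f (Icc a b \ C) := fun t ht =>
    (continuousWithinAt_of_dist_le_sub hM ht.1 (by_contra fun h => ht.2 ⟨ht.1, h⟩)).mono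
      sdiff_subset
  have hae : (Icc a b \ C : Set ℝ) =ᵐ[volume] Icc a b := sdiff_null_ae_eq_self (hC.measure_zero _)
  have hmeas : AEStronglyMeasurable f (volume.restrict (Icc a b)) := by
    rw [← Measure.restrict_congr_set hae]
    exact hcont.aestronglyMeasurable (measurableSet_Icc.diff hC.measurableSet)
  refine Integrable.of_bound hmeas (‖f a‖ + (M b - M a)) ?_
  filter_upwards [ae_restrict_mem measurableSet_Icc] with t ht
  have ha : a ∈ Icc a b := left_mem_Icc.2 (ht.1.trans ht.2)
  have hb : b ∈ Icc a b := right_mem_Icc.2 (ht.1.trans ht.2)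
  have hta := hM a ha t ht ht.1
  have hMtb := monotoneOn_of_dist_le_sub hM ht hb ht.2
  rw [dist_eq_norm] at hta
  linarith [norm_le_norm_add_norm_sub' (f t) (f a)]

end DominatedIncrements

lemma abs_sub_le_varFrom_sub {h : ℝ → ℝ} {a b : ℝ} (hh : BoundedVariationOn h (Icc a b)) {s t : ℝ}
    (hs : s ∈ Icc a b) (ht : t ∈ Icc a b) (hst : s ≤ t) :
    |h t - h s| ≤ varFrom h a t - varFrom h a s := by
  have hmono : ∀ {c d : ℝ}, a ≤ c → d ≤ b → eVariationOn h (Icc c d) ≠ ⊤ := fun hc hd =>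
    hh.mono (Icc_subset_Icc hc hd)
  have hadd : eVariationOn h (Icc a s) + eVariationOn h (Icc s t) = eVariationOn h (Icc a t) := by
    simpa using eVariationOn.Icc_add_Icc h hs.1 hst (mem_univ s)
  rw [varFrom, varFrom, ← hadd, ENNReal.toReal_add (hmono le_rfl hs.2) (hmono hs.1 ht.2),
    add_sub_cancel_left, ← Real.dist_eq]
  exact BoundedVariationOn.dist_le (hmono hs.1 ht.2) (right_mem_Icc.2 hst) (left_mem_Icc.2 hst)

lemma exists_hasRightJump {E : Type*} [NormedAddCommGroup E] [CompleteSpace E] {u : ℝ → E}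
    {a b : ℝ} (hab : a < b) (hu : BoundedVariationOn u (Icc a b)) : ∃ d, HasRightJump u a d := by
  obtain ⟨l, hl⟩ := hu.exists_tendsto_right a
  have hle : 𝓝[>] a ≤ 𝓝[Icc a b ∩ Ioi a] a := by
    rw [← nhdsWithin_Ioc_eq_nhdsGT hab]
    exact nhdsWithin_mono a fun t ht => ⟨Ioc_subset_Icc_self ht, ht.1⟩
  exact ⟨l - u a, (hl.mono_left hle).sub_const _⟩

lemma hasRightJump_id (t : ℝ) : HasRightJump (fun r : ℝ => r) t 0 :=
  sub_self t ▸ ((continuous_id.sub continuous_const).tendsto t).mono_left nhdsWithin_le_nhds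

section Superposition

variable {α E F : Type*} [MeasurableSpace α] {μ : Measure α} [NormedAddCommGroup F]
  {Φ : E → α → F} {Ω : Set E}

lemma aestronglyMeasurable_superposition_simpleFunc (u : SimpleFunc α E) (hu : ∀ t, u t ∈ Ω)
    (hΦ : ∀ y ∈ Ω, AEStronglyMeasurable (Φ y) μ) :
    AEStronglyMeasurable (fun t => Φ (u t) t) μ := by
  have hsum : (fun t => Φ (u t) t)
      = fun t => ∑ y ∈ u.range, (u ⁻¹' {y}).indicator (Φ y) t := by
    funext t
    rw [Finset.sum_eq_single_of_mem (u t) (u.mem_range_self t)]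
    · exact (indicator_of_mem (s := u ⁻¹' {u t}) rfl (Φ (u t))).symm
    · exact fun y _ hy => indicator_of_notMem (fun ht => hy ht.symm) _
  rw [hsum]
  refine Finset.aestronglyMeasurable_fun_sum _ fun y hy => ?_
  obtain ⟨t, rfl⟩ := SimpleFunc.mem_range.1 hy
  exact (hΦ _ (hu t)).indicator (u.measurableSet_preimage _)

theorem aestronglyMeasurable_superposition [PseudoEMetricSpace E] [MeasurableSpace E]
    [OpensMeasurableSpace E] [TopologicalSpace.SeparableSpace Ω] {u : α → E}
    (hu : AEMeasurable u μ) (huΩ : ∀ᵐ t ∂μ, u t ∈ Ω)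
    (hcont : ∀ᵐ t ∂μ, ContinuousOn (fun y => Φ y t) Ω)
    (hΦ : ∀ y ∈ Ω, AEStronglyMeasurable (Φ y) μ) :
    AEStronglyMeasurable (fun t => Φ (u t) t) μ := by
  rcases Ω.eq_empty_or_nonempty with rfl | hΩ
  · have hμ : μ = 0 := ae_eq_bot.1 (eventually_false_iff_eq_bot.1 huΩ)
    exact hμ ▸ aestronglyMeasurable_zero_measure _
  obtain ⟨v, hv, hvΩ, huv⟩ := hu.exists_ae_eq_range_subset huΩ hΩ
  have hvΩ : ∀ t, v t ∈ Ω := fun t => hvΩ (mem_range_self t)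
  obtain ⟨y₀, hy₀⟩ := hΩ
  let A : ℕ → SimpleFunc α E := SimpleFunc.approxOn v hv Ω y₀ hy₀
  have hA : ∀ k t, A k t ∈ Ω := SimpleFunc.approxOn_mem hv hy₀
  suffices AEStronglyMeasurable (fun t => Φ (v t) t) μ from
    this.congr (huv.mono fun t ht => congrArg (Φ · t) ht.symm)
  refine aestronglyMeasurable_of_tendsto_ae atTop
    (fun k => aestronglyMeasurable_superposition_simpleFunc (A k) (hA k) hΦ) ?_
  filter_upwards [hcont] with t ht
  exact (ht (v t) (hvΩ t)).tendsto.comp (tendsto_nhdsWithin_iff.2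
    ⟨SimpleFunc.tendsto_approxOn hv hy₀ (subset_closure (hvΩ t)), .of_forall fun k => hA k t⟩)

end Superposition

section TestFunctions

variable {T : ℝ}

lemma testSpace_apply_eq_zero (φ : testSpace T) {t : ℝ} (ht : t ∉ Ioo 0 T) :
    (φ : ℝ → ℝ) t = 0 := by
  simpa using φ.2.2 0 t ht

lemma absolutelyContinuousOnInterval_testSpace (φ : testSpace T) (a b : ℝ) :
    AbsolutelyContinuousOnInterval (φ : ℝ → ℝ) a b :=
  (φ.2.1.contDiffOn.of_le (by exact_mod_cast le_top)).absolutelyContinuousOnInterval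

lemma integral_Icc_eq_intervalIntegral {E : Type*} [NormedAddCommGroup E] [NormedSpace ℝ E]
    {a b : ℝ} (hab : a ≤ b) (u : ℝ → E) : ∫ t in Icc a b, u t = ∫ t in a..b, u t := by
  rw [intervalIntegral.integral_of_le hab, integral_Icc_eq_integral_Ioc]

lemma integral_deriv_testSpace (hT : 0 ≤ T) (φ : testSpace T) :
    ∫ t in Icc 0 T, deriv (φ : ℝ → ℝ) t = 0 := by
  rw [integral_Icc_eq_intervalIntegral hT,
    (absolutelyContinuousOnInterval_testSpace φ 0 T).integral_deriv_eq_sub,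
    testSpace_apply_eq_zero φ right_notMem_Ioo, testSpace_apply_eq_zero φ left_notMem_Ioo, sub_zero]

lemma integral_deriv_testSpace_mul_primitive (hT : 0 ≤ T) {f : ℝ → ℝ}
    (hf : IntegrableOn f (Icc 0 T)) (φ : testSpace T) :
    ∫ t in Icc 0 T, deriv (φ : ℝ → ℝ) t * ∫ r in 0..t, f r
      = -∫ t in Icc 0 T, (φ : ℝ → ℝ) t * f t := by
  have hf' : IntervalIntegrable f volume 0 T :=
    (intervalIntegrable_iff_integrableOn_Icc_of_le hT).2 hf
  have hprim := hf'.absolutelyContinuousOnInterval_intervalIntegral (c := 0) left_mem_uIcc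
  have hparts :=
    (absolutelyContinuousOnInterval_testSpace φ 0 T).integral_mul_deriv_eq_deriv_mul hprim
  have hderiv : ∫ t in 0..T, (φ : ℝ → ℝ) t * deriv (fun t => ∫ r in 0..t, f r) t
      = ∫ t in 0..T, (φ : ℝ → ℝ) t * f t := by
    refine intervalIntegral.integral_congr_ae ?_
    filter_upwards [hf'.ae_hasDerivAt_integral] with t ht ht'
    rw [(ht (uIoc_subset_uIcc ht') 0 left_mem_uIcc).deriv]
  rw [hderiv, testSpace_apply_eq_zero φ right_notMem_Ioo,
    testSpace_apply_eq_zero φ left_notMem_Ioo, zero_mul, zero_mul, sub_zero, zero_sub] at hparts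
  rw [integral_Icc_eq_intervalIntegral hT, integral_Icc_eq_intervalIntegral hT, hparts, neg_neg]

section VectorValued

variable {E : Type*} [NormedAddCommGroup E] [NormedSpace ℝ E]

lemma integrableOn_testSpace_smul {u : ℝ → E} (hu : IntegrableOn u (Icc 0 T)) (φ : testSpace T) :
    IntegrableOn (fun t => (φ : ℝ → ℝ) t • u t) (Icc 0 T) :=
  hu.continuousOn_smul φ.2.1.continuous.continuousOn isCompact_Icc

lemma integrableOn_deriv_testSpace_smul {u : ℝ → E} (hu : IntegrableOn u (Icc 0 T))
    (φ : testSpace T) : IntegrableOn (fun t => deriv (φ : ℝ → ℝ) t • u t) (Icc 0 T) :=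
  integrableOn_testSpace_smul hu (testDeriv T φ)

lemma integrableOn_primitive {f : ℝ → E} (hT : 0 ≤ T) (hf : IntegrableOn f (Icc 0 T)) :
    IntegrableOn (fun t => ∫ r in 0..t, f r) (Icc 0 T) := by
  rw [← uIcc_of_le hT] at hf ⊢
  exact (intervalIntegral.continuousOn_primitive_interval hf).integrableOn_compact isCompact_uIcc

lemma integral_deriv_testSpace_smul_primitive [CompleteSpace E] (hT : 0 ≤ T) {f : ℝ → E}
    (hf : IntegrableOn f (Icc 0 T)) (φ : testSpace T) :
    ∫ t in Icc 0 T, deriv (φ : ℝ → ℝ) t • ∫ r in 0..t, f r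
      = -∫ t in Icc 0 T, (φ : ℝ → ℝ) t • f t := by
  refine (SeparatingDual.eq_iff_forall_dual_eq (R := ℝ)).2 fun L => ?_
  have hL : ∀ t ∈ Icc 0 T, L (∫ r in 0..t, f r) = ∫ r in 0..t, L (f r) := fun t ht =>
    (L.intervalIntegral_comp_comm ((intervalIntegrable_iff_integrableOn_Icc_of_le ht.1).2
      (hf.mono_set (Icc_subset_Icc_right ht.2)))).symm
  rw [map_neg, ← L.integral_comp_comm (integrableOn_testSpace_smul hf φ), ← L.integral_comp_comm
    (integrableOn_deriv_testSpace_smul (integrableOn_primitive hT hf) φ)]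
  simp only [map_smul, smul_eq_mul]
  rw [← integral_deriv_testSpace_mul_primitive hT (L.integrable_comp hf)]
  exact setIntegral_congr_fun measurableSet_Icc fun t ht => by simp only [hL t ht]

lemma primitive_eq_zero_of_notMem_Ioo {a b : ℝ} {θ : ℝ → E}
    (hint : IntervalIntegrable θ volume a b) (hθ : ∀ t ∉ Ioo a b, θ t = 0)
    (hzero : ∫ t in a..b, θ t = 0) {t : ℝ} (ht : t ∉ Ioo a b) : ∫ r in a..t, θ r = 0 := by
  rcases le_or_gt t a with hta | hat
  · refine intervalIntegral.integral_zero_ae (.of_forall fun r hr => hθ r fun hr' => ?_)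
    rw [uIoc_of_ge hta] at hr
    exact hr'.1.not_ge hr.2
  · have hbt : b ≤ t := not_lt.1 fun htb => ht ⟨hat, htb⟩
    have hθ_after : EqOn θ 0 (uIoc b t) := fun r hr => hθ r fun hr' => by
      rw [uIoc_of_le hbt] at hr
      exact hr'.2.not_gt hr.1
    have hint_after : IntervalIntegrable θ volume b t :=
      (intervalIntegrable_congr hθ_after).2 .zero
    rw [← intervalIntegral.integral_add_adjacent_intervals hint hint_after, hzero, zero_add,
      intervalIntegral.integral_zero_ae (.of_forall hθ_after)]

end VectorValued

lemma exists_testSpace_deriv_eq (hT : 0 ≤ T) {θ : ℝ → ℝ} (hθ : ContDiff ℝ ∞ θ)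
    (hsupp : tsupport θ ⊆ Ioo 0 T) (hint : ∫ t in Icc 0 T, θ t = 0) :
    ∃ φ : testSpace T, deriv (φ : ℝ → ℝ) = θ := by
  rw [integral_Icc_eq_intervalIntegral hT] at hint
  have hcont := hθ.continuous
  have hderiv : ∀ t, HasDerivAt (fun t => ∫ r in 0..t, θ r) (θ t) t := fun t =>
    intervalIntegral.integral_hasDerivAt_right (hcont.intervalIntegrable _ _)
      (hcont.stronglyMeasurableAtFilter _ _) hcont.continuousAt
  have hderiv_eq : deriv (fun t => ∫ r in 0..t, θ r) = θ := funext fun t => (hderiv t).deriv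
  refine ⟨⟨fun t => ∫ r in 0..t, θ r, contDiff_infty_iff_deriv.2
    ⟨fun t => (hderiv t).differentiableAt, hderiv_eq.symm ▸ hθ⟩, fun j t ht => ?_⟩, hderiv_eq⟩
  cases j with
  | zero =>
    exact primitive_eq_zero_of_notMem_Ioo (hcont.intervalIntegrable _ _)
      (fun t ht => image_eq_zero_of_notMem_tsupport fun h => ht (hsupp h)) hint ht
  | succ j =>
    have hθt : θ =ᶠ[𝓝 t] fun _ => 0 :=
      notMem_tsupport_iff_eventuallyEq.1 fun h => ht (hsupp h)
    rw [iteratedDeriv_succ', hderiv_eq, hθt.iteratedDeriv_eq, iteratedDeriv_const, ite_self]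

lemma exists_contDiff_tsupport_subset_integral_eq_one {a b : ℝ} (hab : a < b) :
    ∃ ρ : ℝ → ℝ, ContDiff ℝ ∞ ρ ∧ tsupport ρ ⊆ Ioo a b ∧ ∫ t in Icc a b, ρ t = 1 := by
  let B : ContDiffBump ((a + b) / 2) := ⟨(b - a) / 8, (b - a) / 4, by linarith, by linarith⟩
  have hsupp : tsupport (B.normed volume) ⊆ Ioo a b := by
    rw [B.tsupport_normed_eq, Real.closedBall_eq_Icc]
    exact Icc_subset_Ioo (by simp only [B]; linarith) (by simp only [B]; linarith)
  refine ⟨B.normed volume, B.contDiff_normed, hsupp, ?_⟩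
  rw [setIntegral_eq_integral_of_forall_compl_eq_zero, B.integral_normed]
  exact fun t ht => image_eq_zero_of_notMem_tsupport fun h => ht (Ioo_subset_Icc_self (hsupp h))

variable {E : Type*} [NormedAddCommGroup E] [NormedSpace ℝ E]

/-- If `∫ ρ = 1`, then `ψ - (∫ ψ) ρ` has vanishing integral, hence is the derivative of a test
function. -/
lemma integral_smul_eq_of_forall_integral_deriv_testSpace_smul_eq_zero (hT : 0 ≤ T) {u : ℝ → E}
    (hu : IntegrableOn u (Icc 0 T))
    (hzero : ∀ φ : testSpace T, ∫ t in Icc 0 T, deriv (φ : ℝ → ℝ) t • u t = 0) {ρ ψ : ℝ → ℝ}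
    (hρ : ContDiff ℝ ∞ ρ) (hρ_supp : tsupport ρ ⊆ Ioo 0 T) (hρ_int : ∫ t in Icc 0 T, ρ t = 1)
    (hψ : ContDiff ℝ ∞ ψ) (hψ_supp : tsupport ψ ⊆ Ioo 0 T) :
    ∫ t in Icc 0 T, ψ t • u t = (∫ t in Icc 0 T, ψ t) • ∫ t in Icc 0 T, ρ t • u t := by
  let k := ∫ t in Icc 0 T, ψ t
  have hint : ∀ {χ : ℝ → ℝ}, ContDiff ℝ ∞ χ → IntegrableOn χ (Icc 0 T) := fun hχ =>
    hχ.continuous.continuousOn.integrableOn_compact isCompact_Icc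
  have hint_smul : ∀ {χ : ℝ → ℝ}, ContDiff ℝ ∞ χ → IntegrableOn (fun t => χ t • u t) (Icc 0 T) :=
    fun hχ => hu.continuousOn_smul hχ.continuous.continuousOn isCompact_Icc
  have hθ_int : ∫ t in Icc 0 T, (ψ t - k * ρ t) = 0 := by
    rw [integral_sub (hint hψ) ((hint hρ).const_mul k), integral_const_mul, hρ_int, mul_one,
      sub_self]
  have hθ_supp : tsupport (fun t => ψ t - k * ρ t) ⊆ Ioo 0 T :=
    (tsupport_sub _ _).trans (union_subset hψ_supp
      ((tsupport_mul_subset_right (f := fun _ => k) (g := ρ)).trans hρ_supp))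
  obtain ⟨φ, hφ⟩ := exists_testSpace_deriv_eq hT (hψ.sub (contDiff_const.mul hρ)) hθ_supp hθ_int
  have hφu := hzero φ
  simp only [hφ, sub_smul, mul_smul] at hφu
  have hρu : IntegrableOn (fun t => k • ρ t • u t) (Icc 0 T) := (hint_smul hρ).smul k
  rwa [integral_sub (hint_smul hψ) hρu, integral_smul, sub_eq_zero] at hφu

theorem forall_integral_deriv_testSpace_smul_eq_zero_iff [CompleteSpace E] (hT : 0 < T) {u : ℝ → E}
    (hu : IntegrableOn u (Icc 0 T)) :
    (∀ φ : testSpace T, ∫ t in Icc 0 T, deriv (φ : ℝ → ℝ) t • u t = 0) ↔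
      ∃ c, ∀ᵐ t ∂volume.restrict (Icc 0 T), u t = c := by
  constructor
  · intro hzero
    obtain ⟨ρ, hρ, hρ_supp, hρ_int⟩ := exists_contDiff_tsupport_subset_integral_eq_one hT
    let c := ∫ t in Icc 0 T, ρ t • u t
    have hint : Integrable (fun t => u t - c) (volume.restrict (Icc 0 T)) :=
      hu.sub (integrable_const c)
    have hae := isOpen_Ioo.ae_eq_zero_of_integral_contDiff_smul_eq_zero (U := Ioo 0 T)
      (hint.locallyIntegrable.locallyIntegrableOn _) fun ψ hψ _ hψ_supp => by
        have hψ_cont := hψ.continuous.continuousOn (s := Icc 0 T)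
        simp only [smul_sub]
        rw [integral_sub (hu.continuousOn_smul hψ_cont isCompact_Icc)
          ((hψ_cont.integrableOn_compact isCompact_Icc).smul_const c), integral_smul_const,
          sub_eq_zero]
        exact integral_smul_eq_of_forall_integral_deriv_testSpace_smul_eq_zero hT.le hu hzero
          hρ hρ_supp hρ_int hψ hψ_supp
    rw [← restrict_Ioo_eq_restrict_Icc] at hae ⊢
    refine ⟨c, ?_⟩
    filter_upwards [hae, ae_restrict_mem measurableSet_Ioo] with t hut ht
    exact sub_eq_zero.1 (hut ht)
  · rintro ⟨c, hc⟩ φ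
    rw [integral_congr_ae (hc.mono fun t ht => congrArg (deriv (φ : ℝ → ℝ) t • ·) ht),
      integral_smul_const, integral_deriv_testSpace hT.le, zero_smul]

end TestFunctions

lemma IsLeftContinuousOn.eq_of_ae_eq {E : Type*} [TopologicalSpace E] [T1Space E] {u : ℝ → E}
    {a b t : ℝ} {c : E} (hu : IsLeftContinuousOn u (Ioc a b))
    (hc : ∀ᵐ t ∂volume.restrict (Icc a b), u t = c) (ht : t ∈ Ioc a b) : u t = c := by
  by_contra hne
  obtain ⟨l, hl, hl_ne⟩ := (mem_nhdsLT_iff_exists_Ioo_subset' ht.1).1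
    ((hu t ht).eventually (isOpen_ne.mem_nhds hne))
  have hdense := Measure.dense_of_ae (ae_imp_of_ae_restrict hc)
  obtain ⟨s, hs, hls, hst⟩ := hdense.exists_between (max_lt hl ht.1)
  exact hl_ne ⟨(le_max_left _ _).trans_lt hls, hst⟩
    (hs ⟨((le_max_right _ _).trans_lt hls).le, hst.le.trans ht.2⟩)

section Distributions

variable {n : ℕ} {T : ℝ} {u v f : ℝ → Vec n}

lemma IsL1.sub (hu : IsL1 T u) (hv : IsL1 T v) : IsL1 T (fun t => u t - v t) :=
  Integrable.sub hu hv

lemma IsL1.primitive (hf : IsL1 T f) (hT : 0 ≤ T) : IsL1 T (fun t => ∫ r in 0..t, f r) :=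
  integrableOn_primitive hT hf

lemma pairing_distOfFun (hu : IsL1 T u) (φ : VecTest n T) :
    pairing (distOfFun u hu) φ = ∑ i, (∫ t in Icc 0 T, (φ i : ℝ → ℝ) t • u t) i := by
  refine (integral_finsetSum _ fun i _ =>
    integrableOn_coord_mul hu i (φ i).2.1.continuous).trans (Finset.sum_congr rfl fun i _ => ?_)
  rw [eval_integral (Integrable.eval (integrableOn_testSpace_smul hu (φ i)))]
  simp only [Pi.smul_apply, smul_eq_mul, mul_comm]

lemma pairing_distDeriv_distOfFun (hu : IsL1 T u) (φ : VecTest n T) :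
    pairing (distDeriv (distOfFun u hu)) φ
      = -∑ i, (∫ t in Icc 0 T, deriv (φ i : ℝ → ℝ) t • u t) i :=
  congrArg Neg.neg (pairing_distOfFun hu (vecTestDeriv n T φ))

lemma vecDistribution_ext {d e : vecDistribution n T} (h : ∀ φ, pairing d φ = pairing e φ) :
    d = e :=
  Subtype.ext (LinearMap.ext h)

lemma distDeriv_distOfFun_sub (hu : IsL1 T u) (hv : IsL1 T v) :
    distDeriv (distOfFun (fun t => u t - v t) (hu.sub hv))
      = distDeriv (distOfFun u hu) - distDeriv (distOfFun v hv) := by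
  refine vecDistribution_ext fun φ => ?_
  change _ = pairing _ φ - pairing _ φ
  simp only [pairing_distDeriv_distOfFun, smul_sub]
  simp only [integral_sub (integrableOn_deriv_testSpace_smul hu _)
    (integrableOn_deriv_testSpace_smul hv _), Pi.sub_apply, Finset.sum_sub_distrib]
  ring

lemma distDeriv_distOfFun_primitive (hT : 0 ≤ T) (hf : IsL1 T f) :
    distDeriv (distOfFun (fun t => ∫ r in 0..t, f r) (hf.primitive hT))
      = distOfFun f hf := by
  refine vecDistribution_ext fun φ => ?_
  simp only [pairing_distDeriv_distOfFun, pairing_distOfFun,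
    integral_deriv_testSpace_smul_primitive hT hf, Pi.neg_apply, Finset.sum_neg_distrib, neg_neg]

lemma distDeriv_distOfFun_eq_zero_iff (hT : 0 < T) (hu : IsL1 T u) :
    distDeriv (distOfFun u hu) = 0 ↔ ∃ c, ∀ᵐ t ∂volume.restrict (Icc 0 T), u t = c := by
  rw [← forall_integral_deriv_testSpace_smul_eq_zero_iff hT hu]
  constructor
  · intro hDu φ
    funext i
    have hφ : pairing (distDeriv (distOfFun u hu)) (Pi.single i φ) = 0 := by rw [hDu]; rfl
    rw [pairing_distDeriv_distOfFun, neg_eq_zero, Finset.sum_eq_single_of_mem i (Finset.mem_univ i)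
      fun j _ hji => by simp [Pi.single_eq_of_ne hji], Pi.single_eq_same] at hφ
    exact hφ
  · refine fun hzero => vecDistribution_ext fun φ => ?_
    simp only [pairing_distDeriv_distOfFun, hzero, Pi.zero_apply, Finset.sum_const_zero, neg_zero]
    rfl

lemma distDeriv_distOfFun_eq_add_iff (hT : 0 < T) (hu : IsL1 T u) (hf : IsL1 T f)
    (hv : IsL1 T v) :
    distDeriv (distOfFun u hu) = distOfFun f hf + distDeriv (distOfFun v hv) ↔
      ∃ c, ∀ᵐ t ∂volume.restrict (Icc 0 T), u t - (∫ r in 0..t, f r) - v t = c := by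
  have hprim := hf.primitive hT.le
  rw [← distDeriv_distOfFun_eq_zero_iff hT ((hu.sub hprim).sub hv),
    distDeriv_distOfFun_sub (hu.sub hprim) hv, distDeriv_distOfFun_sub hu hprim,
    distDeriv_distOfFun_primitive hT.le hf]
  rw [sub_eq_zero (G := vecDistribution n T), sub_eq_iff_eq_add' (G := vecDistribution n T)]

end Distributions

lemma isLeftContinuousOn_Ioc_of_forall_eq {E : Type*} [TopologicalSpace E] {u : ℝ → E} {a b : ℝ}
    {c : E} (hu : ∀ t ∈ Ioc a b, u t = c) : IsLeftContinuousOn u (Ioc a b) := fun t ht => by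
  rw [hu t ht]
  refine tendsto_const_nhds.congr' ?_
  filter_upwards [Ioo_mem_nhdsLT ht.1] with s hs
  exact (hu s ⟨hs.1, hs.2.le.trans ht.2⟩).symm

lemma hasRightJump_zero_iff_of_forall_eq {E : Type*} [NormedAddCommGroup E] {u : ℝ → E} {a b : ℝ}
    {c : E} (hab : a < b) (hu : ∀ t ∈ Ioc a b, u t = c) : HasRightJump u a 0 ↔ u a = c := by
  have hlim : HasRightJump u a (c - u a) := by
    refine tendsto_const_nhds.congr' ?_
    filter_upwards [Ioc_mem_nhdsGT hab] with s hs
    rw [hu s hs]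
  rw [← sub_eq_zero, ← neg_eq_zero, neg_sub]
  exact ⟨fun h0 => tendsto_nhds_unique hlim h0, fun h0 => h0 ▸ hlim⟩

/-- The defect `x(t) - ∫_a^t φ(s) ds - ∫_a^t ψ(s) dh(s)`. A function `x` satisfies the Stieltjes
integral equation with right-hand sides `φ = f(lam, x(·), ·)` and `ψ = g(x(·), ·)` if its defect is
constant. Both integrals are Kurzweil–Stieltjes integrals. -/
noncomputable def stieltjesDefect {E : Type*} [NormedAddCommGroup E] [NormedSpace ℝ E]
    (x φ ψ : ℝ → E) (h : ℝ → ℝ) (a t : ℝ) : E :=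
  x t - ksIntegral φ (fun r => r) a t - ksIntegral ψ h a t

section Defect

variable {E : Type*} [NormedAddCommGroup E] [NormedSpace ℝ E] {x φ ψ : ℝ → E} {h : ℝ → ℝ}
  {a b s t : ℝ}

lemma stieltjesDefect_self : stieltjesDefect x φ ψ h a a = x a := by
  rw [stieltjesDefect, ksIntegral_self, ksIntegral_self, sub_zero, sub_zero]

variable [CompleteSpace E]

lemma stieltjesDefect_eq_iff (hφ : KSIntegrable φ (fun r => r) a b) (hψ : KSIntegrable ψ h a b)
    (has : a ≤ s) (hst : s ≤ t) (htb : t ≤ b) :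
    stieltjesDefect x φ ψ h a t = stieltjesDefect x φ ψ h a s ↔
      x t = x s + ksIntegral φ (fun r => r) s t + ksIntegral ψ h s t := by
  rw [← hφ.ksIntegral_sub_ksIntegral has hst htb, ← hψ.ksIntegral_sub_ksIntegral has hst htb,
    stieltjesDefect, stieltjesDefect, ← sub_eq_zero, ← sub_eq_zero (a := x t)]
  abel_nf

lemma isLeftContinuousOn_stieltjesDefect_iff (hφ : KSIntegrable φ (fun r => r) a b)
    (hψ : KSIntegrable ψ h a b) (hh : IsLeftContinuousOn h (Ioc a b)) :
    IsLeftContinuousOn (stieltjesDefect x φ ψ h a) (Ioc a b) ↔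
      IsLeftContinuousOn x (Ioc a b) := by
  have hF := hφ.isLeftContinuousOn_ksIntegral fun t _ => tendsto_id.mono_left nhdsWithin_le_nhds
  have hG := hψ.isLeftContinuousOn_ksIntegral hh
  refine ⟨fun hw t ht => ?_, fun hx t ht => ((hx t ht).sub (hF t ht)).sub (hG t ht)⟩
  simpa [stieltjesDefect] using ((hw t ht).add (hG t ht)).add (hF t ht)

lemma hasRightJump_stieltjesDefect_zero_iff (hφ : KSIntegrable φ (fun r => r) a b)
    (hψ : KSIntegrable ψ h a b) (hab : a < b) {d : ℝ} (hh : HasRightJump h a d) :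
    HasRightJump (stieltjesDefect x φ ψ h a) a 0 ↔ HasRightJump x a (d • ψ a) := by
  have hF := hφ.hasRightJump_ksIntegral hab (hasRightJump_id a)
  have hG := hψ.hasRightJump_ksIntegral hab hh
  constructor
  · intro hw
    have hsum := (Tendsto.add hw hF).add hG
    rw [zero_smul, zero_add, zero_add] at hsum
    refine hsum.congr fun s => ?_
    rw [stieltjesDefect_self, stieltjesDefect, ksIntegral_self, ksIntegral_self]
    abel
  · intro hx
    have hdiff := (Tendsto.sub hx hF).sub hG
    rw [zero_smul, sub_zero, sub_self] at hdiff
    refine hdiff.congr fun s => ?_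
    rw [stieltjesDefect_self, stieltjesDefect, ksIntegral_self, ksIntegral_self]
    abel

lemma dist_le_sub_of_stieltjesDefect_eq {m m' V : ℝ → ℝ} {c : E}
    (hφ : KSIntegrable φ (fun r => r) a b) (hm : KSIntegrable m (fun r => r) a b)
    (hφm : ∀ t ∈ Icc a b, ‖φ t‖ ≤ m t) (hψ : KSIntegrable ψ h a b) (hm' : KSIntegrable m' V a b)
    (hψm' : ∀ t ∈ Icc a b, ‖ψ t‖ ≤ m' t)
    (hV : ∀ s ∈ Icc a b, ∀ t ∈ Icc a b, s ≤ t → |h t - h s| ≤ V t - V s)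
    (hc : ∀ t ∈ Icc a b, stieltjesDefect x φ ψ h a t = c) :
    ∀ s ∈ Icc a b, ∀ t ∈ Icc a b, s ≤ t → dist (x t) (x s) ≤
      (ksIntegral m (fun r => r) a t + ksIntegral m' V a t)
        - (ksIntegral m (fun r => r) a s + ksIntegral m' V a s) := fun s hs t ht hst => by
  have hF := hφ.norm_ksIntegral_sub_le hm hφm
    (fun r _ r' _ hr => (abs_of_nonneg (sub_nonneg.2 hr)).le) hs.1 hst ht.2
  have hG := hψ.norm_ksIntegral_sub_le hm' hψm' hV hs.1 hst ht.2
  have hx : x t - x s = (ksIntegral φ (fun r => r) a t - ksIntegral φ (fun r => r) a s)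
      + (ksIntegral ψ h a t - ksIntegral ψ h a s) := by
    have hts := (hc t ht).trans (hc s hs).symm
    rw [stieltjesDefect, stieltjesDefect, ← sub_eq_zero] at hts
    rw [← sub_eq_zero, ← hts]
    abel
  rw [dist_eq_norm, hx, add_sub_add_comm]
  exact (norm_add_le _ _).trans (add_le_add hF hG)

end Defect

section Equations

variable {n : ℕ} {T : ℝ} {Ω : Set (Vec n)} {f : ℝ → Vec n → ℝ → Vec n} {g : Vec n → ℝ → Vec n}
  {h : ℝ → ℝ} {lam : ℝ} {x : ℝ → Vec n}

lemma stieltjesEquationAt_iff (hf : KSIntegrable (fun r => f lam (x r) r) (fun r => r) 0 T)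
    (hg : KSIntegrable (fun r => g (x r) r) h 0 T) {s t : ℝ} (hs : 0 ≤ s) (hst : s ≤ t)
    (htT : t ≤ T) :
    StieltjesEquationAt f g h lam x s t ↔
      stieltjesDefect x (fun r => f lam (x r) r) (fun r => g (x r) r) h 0 t
        = stieltjesDefect x (fun r => f lam (x r) r) (fun r => g (x r) r) h 0 s := by
  rw [stieltjesDefect_eq_iff hf hg hs hst htT, StieltjesEquationAt,
    and_iff_right (hf.mono hs hst htT), and_iff_right (hg.mono hs hst htT)]

lemma isSIESolution_iff (hf : KSIntegrable (fun r => f lam (x r) r) (fun r => r) 0 T)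
    (hg : KSIntegrable (fun r => g (x r) r) h 0 T) (hΩ : ∀ t ∈ Icc 0 T, x t ∈ Ω) :
    IsSIESolution T Ω f g h lam x ↔ ∀ t ∈ Icc 0 T,
      stieltjesDefect x (fun r => f lam (x r) r) (fun r => g (x r) r) h 0 t = x 0 := by
  rw [IsSIESolution, and_iff_right hΩ]
  refine forall₂_congr fun t ht => ?_
  rw [stieltjesEquationAt_iff hf hg le_rfl ht.1 ht.2, stieltjesDefect_self]

lemma distDeriv_eq_add_iff_stieltjesDefect_ae_eq (hT : 0 < T) {φ ψ : ℝ → Vec n} (hx : IsL1 T x)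
    (hφ : IsL1 T φ) (hG : IsL1 T (ksIntegral ψ h 0)) :
    distDeriv (distOfFun x hx) = distOfFun φ hφ + distDeriv (distOfFun (ksIntegral ψ h 0) hG) ↔
      ∃ c, ∀ᵐ t ∂volume.restrict (Icc 0 T), stieltjesDefect x φ ψ h 0 t = c := by
  rw [distDeriv_distOfFun_eq_add_iff hT hx hφ hG]
  refine exists_congr fun c => eventually_congr ?_
  filter_upwards [ae_restrict_mem measurableSet_Icc] with t ht
  rw [stieltjesDefect, ksIntegral_id_eq_intervalIntegral hφ ht]

lemma IsMDESolution.stieltjesDefect_eq (hT : 0 < T) (hh : IsLeftContinuousOn h (Ioc 0 T))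
    (H : IsMDESolution T Ω f g h lam x) :
    KSIntegrable (fun r => f lam (x r) r) (fun r => r) 0 T ∧
      KSIntegrable (fun r => g (x r) r) h 0 T ∧
        ∃ c, ∀ t ∈ Ioc 0 T,
          stieltjesDefect x (fun r => f lam (x r) r) (fun r => g (x r) r) h 0 t = c := by
  obtain ⟨-, hleft, -, P, hx, hf, ⟨hg, hG, rfl⟩, hDx⟩ := H
  have hfK : KSIntegrable (fun r => f lam (x r) r) (fun r => r) 0 T :=
    ⟨_, hasKSIntegral_id_of_integrableOn hT.le hf⟩
  obtain ⟨c, hc⟩ := (distDeriv_eq_add_iff_stieltjesDefect_ae_eq hT hx hf hG).1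
    (vecDistribution_ext hDx)
  have hw := (isLeftContinuousOn_stieltjesDefect_iff hfK hg hh).2 hleft
  exact ⟨hfK, hg, c, fun t ht => hw.eq_of_ae_eq hc ht⟩

lemma isMDESolution_of_stieltjesDefect_eq (hT : 0 < T) (hh : IsLeftContinuousOn h (Ioc 0 T))
    (hx_bv : BoundedVariationOn x (Icc 0 T)) (hΩ : ∀ t ∈ Icc 0 T, x t ∈ Ω) (hx : IsL1 T x)
    (hf : IsL1 T (fun r => f lam (x r) r)) (hg : KSIntegrable (fun r => g (x r) r) h 0 T)
    (hG : IsL1 T (ksIntegral (fun r => g (x r) r) h 0)) {c : Vec n}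
    (hc : ∀ t ∈ Ioc 0 T,
      stieltjesDefect x (fun r => f lam (x r) r) (fun r => g (x r) r) h 0 t = c) :
    IsMDESolution T Ω f g h lam x := by
  have hfK : KSIntegrable (fun r => f lam (x r) r) (fun r => r) 0 T :=
    ⟨_, hasKSIntegral_id_of_integrableOn hT.le hf⟩
  have hleft := (isLeftContinuousOn_stieltjesDefect_iff hfK hg hh).1
    (isLeftContinuousOn_Ioc_of_forall_eq hc)
  have hae : ∀ᵐ t ∂volume.restrict (Icc 0 T),
      stieltjesDefect x (fun r => f lam (x r) r) (fun r => g (x r) r) h 0 t = c := by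
    rw [← restrict_Ioc_eq_restrict_Icc]
    exact ae_restrict_of_forall_mem measurableSet_Ioc hc
  have hDx := (distDeriv_eq_add_iff_stieltjesDefect_ae_eq hT hx hf hG).2 ⟨c, hae⟩
  exact ⟨hx_bv, hleft, hΩ, _, hx, hf, ⟨hg, hG, rfl⟩, fun φ => by rw [hDx]; rfl⟩

lemma IsMDESolution.stieltjesEquationAt (hT : 0 < T) (hh : IsLeftContinuousOn h (Ioc 0 T))
    (H : IsMDESolution T Ω f g h lam x) {s t : ℝ} (hs : 0 < s) (hst : s ≤ t) (htT : t ≤ T) :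
    StieltjesEquationAt f g h lam x s t := by
  obtain ⟨hf, hg, c, hc⟩ := H.stieltjesDefect_eq hT hh
  rw [stieltjesEquationAt_iff hf hg hs.le hst htT, hc t ⟨hs.trans_le hst, htT⟩,
    hc s ⟨hs, hst.trans htT⟩]

lemma IsMDESolution.isSIESolution_iff_hasRightJump (hT : 0 < T)
    (hh : IsLeftContinuousOn h (Ioc 0 T)) {d : ℝ} (hd : HasRightJump h 0 d)
    (H : IsMDESolution T Ω f g h lam x) :
    IsSIESolution T Ω f g h lam x ↔ HasRightJump x 0 (d • g (x 0) 0) := by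
  obtain ⟨hf, hg, c, hc⟩ := H.stieltjesDefect_eq hT hh
  rw [← hasRightJump_stieltjesDefect_zero_iff hf hg hT hd,
    hasRightJump_zero_iff_of_forall_eq hT hc, stieltjesDefect_self,
    isSIESolution_iff hf hg H.2.2.1]
  refine ⟨fun H => (H T ⟨hT.le, le_rfl⟩).symm.trans (hc T ⟨hT, le_rfl⟩), fun hx0 t ht => ?_⟩
  rcases ht.1.eq_or_lt with rfl | h0
  · exact stieltjesDefect_self
  · rw [hc t ⟨h0, ht.2⟩, hx0]

lemma IsSIESolution.isMDESolution (hT : 0 < T) (hh_left : IsLeftContinuousOn h (Ioc 0 T))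
    (hh_bv : BoundedVariationOn h (Icc 0 T))
    (hf_cont : ∀ t ∈ Icc 0 T, ContinuousOn (fun y => f lam y t) Ω)
    (hf_meas : ∀ y ∈ Ω, AEStronglyMeasurable (fun t => f lam y t) (volume.restrict (Icc 0 T)))
    {m : ℝ → ℝ} (hm : IntegrableOn m (Icc 0 T))
    (hfm : ∀ y ∈ Ω, ∀ t ∈ Icc 0 T, ‖f lam y t‖ ≤ m t)
    {m' : ℝ → ℝ} (hm' : KSIntegrable m' (varFrom h 0) 0 T)
    (hgm' : ∀ y ∈ Ω, ∀ t ∈ Icc 0 T, ‖g y t‖ ≤ m' t) (H : IsSIESolution T Ω f g h lam x) :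
    IsMDESolution T Ω f g h lam x := by
  obtain ⟨hΩ, heq⟩ := id H
  obtain ⟨hf, hg, -⟩ := heq T (right_mem_Icc.2 hT.le)
  have hc := (isSIESolution_iff hf hg hΩ).1 H
  have hfm_x : ∀ t ∈ Icc 0 T, ‖f lam (x t) t‖ ≤ m t := fun t ht => hfm _ (hΩ t ht) t ht
  have hgm_x : ∀ t ∈ Icc 0 T, ‖g (x t) t‖ ≤ m' t := fun t ht => hgm' _ (hΩ t ht) t ht
  have hV : ∀ s ∈ Icc 0 T, ∀ t ∈ Icc 0 T, s ≤ t → |h t - h s| ≤ varFrom h 0 t - varFrom h 0 s :=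
    fun s hs t ht => abs_sub_le_varFrom_sub hh_bv hs ht
  have hM := dist_le_sub_of_stieltjesDefect_eq hf
    ⟨_, hasKSIntegral_id_of_integrableOn hT.le hm⟩ hfm_x hg hm' hgm_x hV hc
  have hx : IsL1 T x := integrableOn_of_dist_le_sub hM
  have hG : IsL1 T (ksIntegral (fun r => g (x r) r) h 0) :=
    integrableOn_of_dist_le_sub fun s hs t ht hst =>
      (dist_eq_norm _ _).trans_le (hg.norm_ksIntegral_sub_le hm' hgm_x hV hs.1 hst ht.2)
  have hf_x : AEStronglyMeasurable (fun t => f lam (x t) t) (volume.restrict (Icc 0 T)) :=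
    aestronglyMeasurable_superposition hx.aestronglyMeasurable.aemeasurable
      (ae_restrict_of_forall_mem measurableSet_Icc hΩ)
      (ae_restrict_of_forall_mem measurableSet_Icc hf_cont) hf_meas
  have hfL1 : IsL1 T (fun t => f lam (x t) t) :=
    Integrable.mono' hm hf_x (ae_restrict_of_forall_mem measurableSet_Icc hfm_x)
  exact isMDESolution_of_stieltjesDefect_eq hT hh_left (boundedVariationOn_of_dist_le_sub hM) hΩ
    hx hfL1 hg hG fun t ht => hc t (Ioc_subset_Icc_self ht)

end Equations

lemma norm_le_norm1 {n : ℕ} (v : Vec n) : ‖v‖ ≤ norm1 v :=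
  (pi_norm_le_iff_of_nonneg (Finset.sum_nonneg fun _ _ => abs_nonneg _)).2 fun i =>
    Finset.single_le_sum (f := fun i => |v i|) (fun _ _ => abs_nonneg _) (Finset.mem_univ i)

theorem mainTheorem8_general {n : ℕ} {T : ℝ} (hT : 0 < T) {Ω : Set (Vec n)}
    {f : ℝ → Vec n → ℝ → Vec n} {g : Vec n → ℝ → Vec n} {h : ℝ → ℝ} {lam : ℝ}
    (hh_left : IsLeftContinuousOn h (Ioc 0 T)) (hh_bv : BoundedVariationOn h (Icc 0 T))
    (hf_cont : ∀ t ∈ Icc 0 T, ContinuousOn (fun y => f lam y t) Ω)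
    (hf_meas : ∀ y ∈ Ω, AEStronglyMeasurable (fun t => f lam y t) (volume.restrict (Icc 0 T)))
    {m : ℝ → ℝ} (hm : IntegrableOn m (Icc 0 T))
    (hfm : ∀ y ∈ Ω, ∀ t ∈ Icc 0 T, norm1 (f lam y t) ≤ m t)
    {m' : ℝ → ℝ} (hm' : KSIntegrable m' (varFrom h 0) 0 T)
    (hgm' : ∀ y ∈ Ω, ∀ t ∈ Icc 0 T, norm1 (g y t) ≤ m' t) (x : ℝ → Vec n) :
    (IsSIESolution T Ω f g h lam x ↔
      IsMDESolution T Ω f g h lam x ∧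
        ∃ d : ℝ, HasRightJump h 0 d ∧ HasRightJump x 0 (d • g (x 0) 0)) ∧
    (IsMDESolution T Ω f g h lam x →
      ∀ s t : ℝ, 0 < s → s ≤ t → t ≤ T → StieltjesEquationAt f g h lam x s t) := by
  refine ⟨⟨fun H => ?_, fun ⟨H, d, hd, hx⟩ =>
    (H.isSIESolution_iff_hasRightJump hT hh_left hd).2 hx⟩,
    fun H s t hs hst htT => H.stieltjesEquationAt hT hh_left hs hst htT⟩
  have hMDE := H.isMDESolution hT hh_left hh_bv hf_cont hf_meas hm
    (fun y hy t ht => (norm_le_norm1 _).trans (hfm y hy t ht)) hm'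
    (fun y hy t ht => (norm_le_norm1 _).trans (hgm' y hy t ht))
  obtain ⟨d, hd⟩ := exists_hasRightJump hT hh_bv
  exact ⟨hMDE, d, hd, (hMDE.isSIESolution_iff_hasRightJump hT hh_left hd).1 H⟩

theorem mainTheorem8 (n : ℕ) (T : ℝ) (hT : 0 < T)
    (Ω : Set (Vec n)) (hΩ : IsOpen Ω) (Λ : Set ℝ) (hΛ : IsOpen Λ)
    (f : ℝ → Vec n → ℝ → Vec n) (g : Vec n → ℝ → Vec n) (h : ℝ → ℝ)
    (hh_left : IsLeftContinuousOn h (Iic T)) (hh_bv : BoundedVariationOn h (Icc 0 T))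
    (hh_neg : ∀ t < 0, h t = h 0)
    (hf_cont : ∀ lam ∈ Λ, ∀ t ∈ Icc 0 T, ContinuousOn (fun y => f lam y t) Ω)
    (hf_meas : ∀ lam ∈ Λ, ∀ y ∈ Ω,
      AEStronglyMeasurable (fun t => f lam y t) (volume.restrict (Icc 0 T)))
    (hf_bound : ∃ m : ℝ → ℝ, (∀ t ∈ Icc 0 T, 0 ≤ m t) ∧ IntegrableOn m (Icc 0 T) ∧
      ∀ lam ∈ Λ, ∀ y ∈ Ω, ∀ t ∈ Icc 0 T, norm1 (f lam y t) ≤ m t)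
    (hg_cont : ∀ t ∈ Icc 0 T, ContinuousOn (fun y => g y t) Ω)
    (hg_bound : ∃ m : ℝ → ℝ, (∀ t ∈ Icc 0 T, 0 ≤ m t) ∧
      KSIntegrable m (fun t => varFrom h 0 t) 0 T ∧
      ∀ y ∈ Ω, ∀ t ∈ Icc 0 T, norm1 (g y t) ≤ m t)
    (lam : ℝ) (hlam : lam ∈ Λ) (x : ℝ → Vec n) (hx : IsRegulatedOn x 0 T) :
    (IsSIESolution T Ω f g h lam x ↔
      IsMDESolution T Ω f g h lam x ∧
        ∃ d : ℝ, HasRightJump h 0 d ∧ HasRightJump x 0 (d • g (x 0) 0)) ∧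
    (IsMDESolution T Ω f g h lam x →
      ∀ s t : ℝ, 0 < s → s ≤ t → t ≤ T → StieltjesEquationAt f g h lam x s t) := by
  obtain ⟨m, -, hm, hfm⟩ := hf_bound
  obtain ⟨m', -, hm', hgm'⟩ := hg_bound
  exact mainTheorem8_general hT (fun t ht => hh_left t ht.2) hh_bv (hf_cont lam hlam)
    (hf_meas lam hlam) hm (hfm lam hlam) hm' hgm' x
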